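/- **Setting.** Let $f:\mathbb R^n\to\mathbb R$ be differentiable, $\mu$-strongly convex with $\mu\ge 0$, i.e. $f(y)\ge f(x)+\langle\nabla f(x),y-x\rangle+\frac{\mu}{2}\|y-x\|^2$ for all $x,y$, and $L$-smooth, i.e. $\|\nabla f(x)-\nabla f(y)\|\le L\|x-y\|$ for all $x,y$; let $\theta^*$ be a minimizer of $f$. There are $N$ peers, and $P_k\subseteq\{1,\dots,N\}$ is the (random) set of peers participating at iteration $k$, with $P_0=\{1,\dots,N\}$ and $N_k=|P_k|$. *Moshpit SGD* with starting point $\theta^0$, stepsize $\gamma>0$ and communication period $\tau\ge 1$ starts with $\theta_i^0=\theta^0$ for all $i$ and performs, for $k\ge 0$ and $i\in P_{k+1}$, the local step $\theta_i^{k+1}=\theta_i^k-\gamma g_i^k$ if $\tau\nmid k+1$; if $\tau\mid k+1$, the vectors $\theta_i^{k+1}$, $i\in P_{k+1}$, are the output of Moshpit All-Reduce applied to the vectors $\theta_j^k-\gamma g_j^k$, $j\in P_{k+1}$. *Moshpit All-Reduce* (on a $d$-dimensional grid with $M$ positions per dimension, $T$ rounds) repeatedly splits the peers that successfully run the round into groups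 with equal keys, where the key of a peer consists of its chunk indices from $\{1,\dots,M\}$ received in the $d-1$ preceding rounds (initially, of an arbitrary initial index); every member of a group replaces its vector by the average over the group and receives a chunk index unique in its group; the other peers skip the round. Write $\theta^k=\frac1{N_k}\sum_{i\in P_k}\theta_i^k$ and $\widehat\theta^{k+1}=\frac1{N_k}\sum_{i\in P_k}(\theta_i^k-\gamma g_i^k)$. **Assumptions.** (1) For all $k\ge0$ and $i=1,\dots,N$ the stochastic gradients satisfy $\mathbb E[g_i^k\mid\theta_i^k]=\nabla f(\theta_i^k)$ and $\mathbb E[\|g_i^k-\nabla f(\theta_i^k)\|^2\mid\theta_i^k]\le\sigma^2$, and they are computed independently: given $\theta_i^k$, $g_i^k$ is conditionally independent of the other gradients $g_j^k$, $j\ne i$, and of the history (participating peers and iterates up to iteration $k$, gradients of earlier iterations). (2) $P_{k+1}\subseteq P_k$ and $|P_k|\ge N_{\min}\ge 1$ for all $k\ge0$, $|P_{a\tau}|\le 2|P_{(a+1)\tau}|$ for all integers $a\ge 0$, and for all $k\ge0$ $$\mathbb E\big[\langle\theta^{k+1}-\widehat\theta^{k+1},\theta^{k+1}+\widehat\theta^{k+1}-2\theta^*\rangle\big]\le\delta_{pv,1}\gamma\mu\,\mathbb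 E\big[\|\theta^k-\theta^*\|^2\big]+\gamma^2\delta_{pv,2}^2,$$ where $\delta_{pv,1}\in[0,1)$, $\delta_{pv,2}\ge0$. (3) For some $\delta_{aq}\ge 0$ and all integers $a\ge0$, $\mathbb E\big[\frac1{N_{a\tau}}\sum_{i\in P_{a\tau}}\|\theta_i^{a\tau}-\theta^{a\tau}\|^2\big]\le\gamma^2\delta_{aq}^2$. **Theorem.** Let $R_0=\|\theta^0-\theta^*\|$ and, for $\varepsilon>0$, $$B_0=\frac{LR_0^2}{\varepsilon}+\frac{R_0^2(\delta_{pv,2}^2+\sigma^2/N_{\min})}{\varepsilon^2}+\frac{R_0^2\sqrt{L((\tau-1)\sigma^2+\delta_{aq}^2)}}{\varepsilon^{3/2}},$$ and, if $\mu>0$, $$B=\frac{L}{(1-\delta_{pv,1})\mu}+\frac{\delta_{pv,2}^2+\sigma^2/N_{\min}}{(1-\delta_{pv,1})\mu\varepsilon}+\sqrt{\frac{L((\tau-1)\sigma^2+\delta_{aq}^2)}{(1-\delta_{pv,1})^2\mu^2\varepsilon}}.$$ There is a universal constant $C>0$ such that, both for $\rho=\mu$ and for $\rho=(1-\delta_{pv,1})\mu$,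 there exist a stepsize $\gamma>0$ and an integer $K_0\ge 0$, depending only on $\rho,\mu,L,\sigma,\delta_{pv,1},\delta_{pv,2},\delta_{aq},R_0,\varepsilon,\tau,N_{\min}$, with $$K_0\le C\,B\,\ln(2+B_0)\ \text{ if }\mu>0,\qquad K_0\le C\,B_0\ \text{ if }\mu=0,$$ such that for every run of Moshpit SGD with stepsize $\gamma$ satisfying (1)–(3) and every $K\ge K_0$ $$\mathbb E\big[f(\overline\theta^K)-f(\theta^*)\big]\le\varepsilon,\qquad \overline\theta^K=\frac1{W_K}\sum_{k=0}^K\frac1{N_k}\sum_{i\in P_k}w_k\theta_i^k,\quad w_k=(1-\gamma\rho)^{-(k+1)},\quad W_K=\sum_{k=0}^Kw_k .$$ That is, $K=\widetilde{\mathcal O}(B)$ iterations suffice for $\mu>0$, where $\widetilde{\mathcal O}$ hides a universal constant and the factor $\ln(2+B_0)$, which is $\mathcal O(\log(1/\varepsilon))$ as $\varepsilon\to0$ with the other parameters fixed, and $K=\mathcal O(B_0)$ iterations suffice for $\mu=0$. -/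

import Mathlib

open MeasureTheory ProbabilityTheory
open scoped RealInnerProductSpace

noncomputable section

/-- The parameter space `ℝⁿ` with its Euclidean structure. -/
abbrev Vec (n : ℕ) : Type := EuclideanSpace ℝ (Fin n)

/-- `f : ℝⁿ → ℝ` is `L`-smooth: it is differentiable with an `L`-Lipschitz gradient. -/
def IsLSmooth {n : ℕ} (L : ℝ) (f : Vec n → ℝ) : Prop :=
  Differentiable ℝ f ∧ ∀ x y, ‖gradient f x - gradient f y‖ ≤ L * ‖x - y‖

/-- A differentiable `f : ℝⁿ → ℝ` is `μ`-strongly convex (`μ = 0` means convex). -/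
def IsMuStronglyConvex {n : ℕ} (μ : ℝ) (f : Vec n → ℝ) : Prop :=
  Differentiable ℝ f ∧
    ∀ x y, f x + ⟪gradient f x, y - x⟫ + μ / 2 * ‖y - x‖ ^ 2 ≤ f y

/-- The average of the vectors `x i`, `i ∈ S`. -/
def peerAvg {n N : ℕ} (S : Finset (Fin N)) (x : Fin N → Vec n) : Vec n :=
  (S.card : ℝ)⁻¹ • ∑ i ∈ S, x i

/-- The groupmates of peer `i` in an averaging round: the peers of `A` that have the same group
key. The key of a peer in round `t` consists of its chunk indices number `t, …, t + (d - 1) - 1`;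
the chunk indices `0, …, d - 2` are the initial index of the peer, and the chunk index obtained in
round `t` is the one with number `t + (d - 1)`. -/
def moshpitGroup {N M : ℕ} (d : ℕ) (c : Fin N → ℕ → Fin M) (A : Finset (Fin N)) (t : ℕ)
    (i : Fin N) : Finset (Fin N) :=
  A.filter fun j => ∀ s < d - 1, c j (t + s) = c i (t + s)

/-- `y` is a possible result of Moshpit All-Reduce among the peers of `S` with input vectors `x`,
on a `d`-dimensional grid with `M` positions per dimension, after `T` rounds (`t = 0, …, T - 1`).
In round `t` the set `A t` of peers that successfully run the round is split into groups with equal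
keys; each of them replaces its vector by the average over its group and receives a chunk index
that is unique in the group. A peer that does not complete the round, because of its own failure
or of a failure in its group, keeps its vector. -/
def IsMoshpitAllReduce {n N : ℕ} (d M T : ℕ) (S : Finset (Fin N)) (x y : Fin N → Vec n) : Prop :=
  ∃ (v : ℕ → Fin N → Vec n) (A : ℕ → Finset (Fin N)) (c : Fin N → ℕ → Fin M),
    (∀ i ∈ S, v 0 i = x i) ∧
    (∀ t < T, A t ⊆ S ∧
      (∀ i ∈ A t, v (t + 1) i = peerAvg (moshpitGroup d c (A t) t i) (v t)) ∧
      (∀ i ∈ S \ A t, v (t + 1) i = v t i) ∧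
      (∀ i ∈ A t, ∀ j ∈ moshpitGroup d c (A t) t i,
        c j (t + (d - 1)) = c i (t + (d - 1)) → j = i)) ∧
    (∀ i ∈ S, y i = v T i)

/-- One run of Moshpit SGD: `P k` is the set of participating peers, `θ k i` the iterate of peer
`i` and `g k i` its stochastic gradient at `θ k i`, all of them random. -/
structure MoshpitRun (Ω : Type*) [MeasurableSpace Ω] (n N : ℕ) where
  P : ℕ → Ω → Finset (Fin N)
  θ : ℕ → Fin N → Ω → Vec n
  g : ℕ → Fin N → Ω → Vec n
  measurable_P : ∀ k, Measurable[_, ⊤] (P k)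
  measurable_θ : ∀ k i, Measurable (θ k i)
  measurable_g : ∀ k i, Measurable (g k i)

namespace MoshpitRun

variable {Ω : Type*} [MeasurableSpace Ω] {n N : ℕ} (X : MoshpitRun Ω n N)

/-- The global average `θᵏ = (1 / N_k) ∑_{i ∈ P_k} θ_iᵏ`. -/
def mean (k : ℕ) (ω : Ω) : Vec n := peerAvg (X.P k ω) fun i => X.θ k i ω

/-- `X.hat γ k` is `θ̂ᵏ⁺¹ = (1 / N_k) ∑_{i ∈ P_k} (θ_iᵏ - γ g_iᵏ)`. -/
def hat (γ : ℝ) (k : ℕ) (ω : Ω) : Vec n :=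
  peerAvg (X.P k ω) fun i => X.θ k i ω - γ • X.g k i ω

/-- The weights `w_k = (1 - γ ρ)^{-(k + 1)}`. -/
def weight (γ ρ : ℝ) (k : ℕ) : ℝ := ((1 - γ * ρ) ^ (k + 1))⁻¹

/-- The output `θ̄ᴷ = (1 / W_K) ∑_{k ≤ K} (1 / N_k) ∑_{i ∈ P_k} w_k θ_iᵏ`,
where `W_K = ∑_{k ≤ K} w_k`. -/
def output (γ ρ : ℝ) (K : ℕ) (ω : Ω) : Vec n :=
  (∑ k ∈ Finset.range (K + 1), weight γ ρ k)⁻¹ •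
    ∑ k ∈ Finset.range (K + 1), peerAvg (X.P k ω) fun i => weight γ ρ k • X.θ k i ω

/-- The σ-algebra of what has happened when the gradients of iteration `k` are computed: the
participating peers and the iterates up to iteration `k` and the earlier stochastic gradients. -/
abbrev history (k : ℕ) : MeasurableSpace Ω :=
  (⨆ l ≤ k, MeasurableSpace.comap (X.P l) ⊤) ⊔
    (⨆ l ≤ k, ⨆ i, MeasurableSpace.comap (X.θ l i) inferInstance) ⊔
    (⨆ l < k, ⨆ i, MeasurableSpace.comap (X.g l i) inferInstance)

/-- The σ-algebra generated by the current point `θ_iᵏ` of peer `i`. -/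
abbrev atPoint (k : ℕ) (i : Fin N) : MeasurableSpace Ω :=
  MeasurableSpace.comap (X.θ k i) inferInstance

/-- The run follows Moshpit SGD with starting point `θ₀`, learning rate `γ`, communication period
`τ`, and Moshpit All-Reduce with parameters `d`, `M`, `T`. -/
structure IsMoshpitSGD (d M T : ℕ) (θ₀ : Vec n) (γ : ℝ) (τ : ℕ) : Prop where
  initial_peers : ∀ ω, X.P 0 ω = Finset.univ
  initial_point : ∀ i ω, X.θ 0 i ω = θ₀
  local_step : ∀ k, ¬ τ ∣ k + 1 → ∀ ω, ∀ i ∈ X.P (k + 1) ω,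
    X.θ (k + 1) i ω = X.θ k i ω - γ • X.g k i ω
  averaging_step : ∀ k, τ ∣ k + 1 → ∀ ω,
    IsMoshpitAllReduce d M T (X.P (k + 1) ω) (fun j => X.θ k j ω - γ • X.g k j ω)
      (fun j => X.θ (k + 1) j ω)

end MoshpitRun

/-- The σ-algebras `m₁` and `m₂` are conditionally independent given `m` (Mathlib's `CondIndep`
is available on standard Borel spaces only). -/
def CondIndepGiven {Ω : Type*} [MeasurableSpace Ω] (Pr : Measure Ω)
    (m m₁ m₂ : MeasurableSpace Ω) : Prop :=
  ∀ A B : Set Ω, MeasurableSet[m₁] A → MeasurableSet[m₂] B →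
    Pr⟦A ∩ B | m⟧ =ᵐ[Pr] Pr⟦A | m⟧ * Pr⟦B | m⟧

namespace MoshpitRun

variable {Ω : Type*} [MeasurableSpace Ω] {n N : ℕ} (X : MoshpitRun Ω n N)

/-- The stochastic gradients are unbiased with variance at most `σ²`, given the point where they
are computed, and they are computed independently: given `θ_iᵏ`, the stochastic gradient `g_iᵏ` is
independent of the history and of the other stochastic gradients of the same iteration. -/
structure BoundedVariance (Pr : Measure Ω) (f : Vec n → ℝ) (σ : ℝ) : Prop where
  integrable : ∀ k i, Integrable (X.g k i) Pr
  unbiased : ∀ k i, Pr[X.g k i | X.atPoint k i] =ᵐ[Pr] fun ω => gradient f (X.θ k i ω)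
  square_integrable : ∀ k i,
    Integrable (fun ω => ‖X.g k i ω - gradient f (X.θ k i ω)‖ ^ 2) Pr
  variance_le : ∀ k i,
    Pr[fun ω => ‖X.g k i ω - gradient f (X.θ k i ω)‖ ^ 2 | X.atPoint k i] ≤ᵐ[Pr] fun _ => σ ^ 2
  independent : ∀ k i, CondIndepGiven Pr (X.atPoint k i)
    (MeasurableSpace.comap (X.g k i) inferInstance)
    (X.history k ⊔ ⨆ j, ⨆ _ : j ≠ i, MeasurableSpace.comap (X.g k j) inferInstance)

/-- The assumption on the averaging quality and on vanishing peers in the convex case, with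
`Δ_pvᵏ = δpv₁ γ μ 𝔼‖θᵏ - θ⋆‖² + γ² δpv₂²` and the reference point `θ⋆`. -/
structure AveragingQuality (Pr : Measure Ω) (γ μ δpv₁ δpv₂ δaq : ℝ) (τ Nmin : ℕ)
    (θstar : Vec n) : Prop where
  peers_antitone : ∀ k ω, X.P (k + 1) ω ⊆ X.P k ω
  le_card_peers : ∀ k ω, Nmin ≤ (X.P k ω).card
  card_peers_le : ∀ a ω, (X.P (a * τ) ω).card ≤ 2 * (X.P ((a + 1) * τ) ω).card
  vanishing : ∀ k,
    ∫ ω, ⟪X.mean (k + 1) ω - X.hat γ k ω,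
        X.mean (k + 1) ω + X.hat γ k ω - (2 : ℝ) • θstar⟫ ∂Pr
      ≤ δpv₁ * γ * μ * (∫ ω, ‖X.mean k ω - θstar‖ ^ 2 ∂Pr) + γ ^ 2 * δpv₂ ^ 2
  averaging : ∀ a,
    ∫ ω, ((X.P (a * τ) ω).card : ℝ)⁻¹ *
        ∑ i ∈ X.P (a * τ) ω, ‖X.θ (a * τ) i ω - X.mean (a * τ) ω‖ ^ 2 ∂Pr
      ≤ γ ^ 2 * δaq ^ 2

end MoshpitRun

/-- The complexity
`L R₀² / ε + R₀² (δpv₂² + σ² / Nmin) / ε² + R₀² √(L ((τ - 1) σ² + δaq²)) / ε^{3/2}`. -/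
def convexComplexity (L σ δpv₂ δaq R₀ ε : ℝ) (τ Nmin : ℕ) : ℝ :=
  L * R₀ ^ 2 / ε + R₀ ^ 2 * (δpv₂ ^ 2 + σ ^ 2 / Nmin) / ε ^ 2
    + R₀ ^ 2 * √(L * (((τ : ℝ) - 1) * σ ^ 2 + δaq ^ 2)) / ε ^ (3 / 2 : ℝ)

/-- The complexity `L / ((1 - δpv₁) μ) + (δpv₂² + σ² / Nmin) / ((1 - δpv₁) μ ε)
+ √(L ((τ - 1) σ² + δaq²) / ((1 - δpv₁)² μ² ε))`. -/
def stronglyConvexComplexity (μ L σ δpv₁ δpv₂ δaq ε : ℝ) (τ Nmin : ℕ) : ℝ :=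
  L / ((1 - δpv₁) * μ) + (δpv₂ ^ 2 + σ ^ 2 / Nmin) / ((1 - δpv₁) * μ * ε)
    + √(L * (((τ : ℝ) - 1) * σ ^ 2 + δaq ^ 2) / ((1 - δpv₁) ^ 2 * μ ^ 2 * ε))

end

/-!
The proof follows the average `θᵏ` of the participating iterates. Write `a k = 𝔼‖θᵏ - θ⋆‖²` and
`r k = 𝔼[f(θᵏ) - f(θ⋆)]`.

Given the history, the gradient noise of a peer is centred, has variance at most `σ²`, and is
orthogonal to the noise of the other peers. This needs conditional independence in the form
"conditioning on more than `θ_iᵏ` changes nothing" (`CondIndepGiven.condExp_eq`). An iteration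
therefore acts on `θᵏ` like a gradient step with noise of variance `σ² / N_k`, where the gradient is
averaged over the points `θ_iᵏ` instead of being taken at `θᵏ`; convexity and smoothness bound the
effect of this by the variance of the `θ_iᵏ` (`IsMuStronglyConvex.averaged_step`). That variance
starts each period at `γ² δaq²` or less, and a local step increases it by noise only, since gradient
steps are nonexpansive (`pair_step`). Peers may leave in a way that depends on the noise, so the
drift is measured by pairwise squared distances normalized by the number of peers at the beginning
of the period, which can only decrease when peers leave; as at least half of the peers remain, this
controls the variance (`variance_le_dispersion`). With the assumption on vanishing peers this gives

  `a (k + 1) ≤ (1 - γ μ (1 - δpv₁)) a k - (3 / 2) γ r k + γ e`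

with `e = γ (δpv₂² + σ² / Nmin) + 24 γ² L ((τ - 1) σ² + δaq²)` (`integral_mean_succ_le`).

The weights for `ρ = μ (1 - δpv₁)` make the recursion telescope. The weights for `ρ = μ` grow faster
than the recursion contracts and leave a term `γ μ δpv₁ ∑ w_k a k`. But strong convexity gives
`(μ / 2) a k ≤ r k`, and with the factor `3 / 2` in front of `γ r k` the distances in fact contract at
the rate `γ μ / 2` down to `2 e / μ`, whatever `δpv₁ < 1` is (`distance_bound`), so the extra term
costs constant factors only (`weighted_sum_le`).

The stepsize is `γ = 1 / (64 S)`, where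
`S = L + (δpv₂² + σ² / Nmin) / ε + √(L ((τ - 1) σ² + δaq²) / ε)`. Then `e ≤ ε / 32`, and the two
complexities are exactly `S / (μ (1 - δpv₁))` and `R₀² S / ε`.
-/

/-! ### Smooth convex functions -/

section Smooth

variable {n : ℕ} {f : Vec n → ℝ} {μ L : ℝ}

theorem IsMuStronglyConvex.first_order (hf : IsMuStronglyConvex μ f) (hμ : 0 ≤ μ) (x y : Vec n) :
    f x + ⟪gradient f x, y - x⟫ ≤ f y := by
  have h := hf.2 x y
  have : 0 ≤ μ / 2 * ‖y - x‖ ^ 2 := by positivity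
  linarith

/-- The descent inequality with constant `L` in place of the sharp `L / 2`, which convexity makes
immediate. -/
theorem IsMuStronglyConvex.le_quadratic (hf : IsMuStronglyConvex μ f) (hμ : 0 ≤ μ)
    (hL : IsLSmooth L f) (x y : Vec n) :
    f y ≤ f x + ⟪gradient f x, y - x⟫ + L * ‖y - x‖ ^ 2 := by
  have h1 := hf.first_order hμ y x
  have h2 : ⟪gradient f y - gradient f x, y - x⟫ ≤ L * ‖y - x‖ * ‖y - x‖ :=
    (real_inner_le_norm _ _).trans
      (mul_le_mul_of_nonneg_right (hL.2 y x) (norm_nonneg _))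
  have h3 : ⟪gradient f y, x - y⟫ = -⟪gradient f y, y - x⟫ := by
    rw [← inner_neg_right, neg_sub]
  rw [inner_sub_left] at h2
  nlinarith

/-- Apply the descent inequality at a gradient step of `f - ⟪∇f x, ·⟫`, whose minimizer is `x`. -/
theorem IsMuStronglyConvex.grad_sub_sq_le (hf : IsMuStronglyConvex μ f) (hμ : 0 ≤ μ) (hL0 : 0 < L)
    (hL : IsLSmooth L f) (x y : Vec n) :
    f x + ⟪gradient f x, y - x⟫ + ‖gradient f y - gradient f x‖ ^ 2 / (4 * L) ≤ f y := by
  set D := gradient f y - gradient f x with hD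
  have h1 := hf.first_order hμ x (y - (2 * L)⁻¹ • D)
  have h2 := hf.le_quadratic hμ hL y (y - (2 * L)⁻¹ • D)
  have e1 : y - (2 * L)⁻¹ • D - x = (y - x) - (2 * L)⁻¹ • D := by abel
  have e2 : y - (2 * L)⁻¹ • D - y = -((2 * L)⁻¹ • D) := by abel
  rw [e1, inner_sub_right, inner_smul_right] at h1
  rw [e2, inner_neg_right, inner_smul_right, norm_neg, norm_smul, mul_pow, Real.norm_eq_abs,
    sq_abs] at h2
  have h3 : ⟪gradient f y, D⟫ - ⟪gradient f x, D⟫ = ‖D‖ ^ 2 := by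
    rw [← inner_sub_left, ← hD, real_inner_self_eq_norm_sq]
  have h4 : (2 * L)⁻¹ * ‖D‖ ^ 2 - L * ((2 * L)⁻¹ ^ 2 * ‖D‖ ^ 2) = ‖D‖ ^ 2 / (4 * L) := by
    field_simp; ring
  have h5 : (2 * L)⁻¹ * ⟪gradient f y, D⟫ - (2 * L)⁻¹ * ⟪gradient f x, D⟫
      = (2 * L)⁻¹ * ‖D‖ ^ 2 := by rw [← h3]; ring
  linarith

theorem gradient_eq_zero_of_minimizer {θstar : Vec n} (hmin : ∀ x, f θstar ≤ f x) :
    gradient f θstar = 0 := by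
  have : IsLocalMin f θstar := Filter.Eventually.of_forall hmin
  simp [gradient, this.fderiv_eq_zero]

theorem IsMuStronglyConvex.grad_sq_le (hf : IsMuStronglyConvex μ f) (hμ : 0 ≤ μ) (hL0 : 0 < L)
    (hL : IsLSmooth L f) {θstar : Vec n} (hmin : ∀ x, f θstar ≤ f x) (x : Vec n) :
    ‖gradient f x‖ ^ 2 ≤ 4 * L * (f x - f θstar) := by
  have h := hf.grad_sub_sq_le hμ hL0 hL θstar x
  rw [gradient_eq_zero_of_minimizer hmin, inner_zero_left, sub_zero, add_zero] at h
  have h2 : ‖gradient f x‖ ^ 2 / (4 * L) ≤ f x - f θstar := by linarith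
  rw [div_le_iff₀ (by positivity)] at h2
  linarith

theorem IsMuStronglyConvex.dist_sq_le (hf : IsMuStronglyConvex μ f) {θstar : Vec n}
    (hmin : ∀ x, f θstar ≤ f x) (x : Vec n) :
    μ / 2 * ‖x - θstar‖ ^ 2 ≤ f x - f θstar := by
  have h := hf.2 θstar x
  rw [gradient_eq_zero_of_minimizer hmin, inner_zero_left] at h
  linarith

theorem IsMuStronglyConvex.sub_min_le (hf : IsMuStronglyConvex μ f) (hμ : 0 ≤ μ)
    (hL : IsLSmooth L f) {θstar : Vec n} (hmin : ∀ x, f θstar ≤ f x) (x : Vec n) :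
    f x - f θstar ≤ L * ‖x - θstar‖ ^ 2 := by
  have h := hf.le_quadratic hμ hL θstar x
  rw [gradient_eq_zero_of_minimizer hmin, inner_zero_left] at h
  linarith

/-- Gradient steps are nonexpansive, because the gradient is cocoercive. -/
theorem IsMuStronglyConvex.gradient_step_nonexpansive (hf : IsMuStronglyConvex μ f) (hμ : 0 ≤ μ)
    (hL0 : 0 < L) (hL : IsLSmooth L f) {γ : ℝ} (hγ : 0 ≤ γ) (hγL : γ * L ≤ 1) (x y : Vec n) :
    ‖(x - γ • gradient f x) - (y - γ • gradient f y)‖ ^ 2 ≤ ‖x - y‖ ^ 2 := by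
  have h1 := hf.grad_sub_sq_le hμ hL0 hL x y
  have h2 := hf.grad_sub_sq_le hμ hL0 hL y x
  set D := gradient f x - gradient f y with hD
  have e0 : ‖gradient f y - gradient f x‖ = ‖D‖ := norm_sub_rev _ _
  have e1 : ⟪gradient f x, y - x⟫ = -⟪gradient f x, x - y⟫ := by
    rw [← inner_neg_right, neg_sub]
  have e2 : ⟪D, x - y⟫ = ⟪gradient f x, x - y⟫ - ⟪gradient f y, x - y⟫ := inner_sub_left _ _ _
  have e3 : (x - γ • gradient f x) - (y - γ • gradient f y) = (x - y) - γ • D := by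
    rw [hD, smul_sub]; abel
  rw [e0, e1] at h1
  have h3 : ‖D‖ ^ 2 / (2 * L) ≤ ⟪D, x - y⟫ := by
    have : ‖D‖ ^ 2 / (2 * L) = ‖D‖ ^ 2 / (4 * L) + ‖D‖ ^ 2 / (4 * L) := by field_simp; ring
    linarith
  rw [div_le_iff₀ (by positivity)] at h3
  rw [e3, norm_sub_sq_real, inner_smul_right, norm_smul, mul_pow, Real.norm_eq_abs, sq_abs,
    real_inner_comm]
  have h5 : γ * ‖D‖ ^ 2 ≤ γ * (⟪D, x - y⟫ * (2 * L)) := mul_le_mul_of_nonneg_left h3 hγ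
  have h6 : 0 ≤ γ * ⟪D, x - y⟫ := by
    refine mul_nonneg hγ (nonneg_of_mul_nonneg_left ((sq_nonneg _).trans h3) (by positivity))
  nlinarith [mul_le_mul_of_nonneg_left h5 hγ, mul_le_mul_of_nonneg_right hγL h6]

/-- If `L = 0`, or if `L < μ` (which leaves only `n = 0`), then `f` is constant. -/
theorem eq_min_of_degenerate (hf : IsMuStronglyConvex μ f) (hμ : 0 ≤ μ)
    (hL : IsLSmooth L f) (hL0 : 0 ≤ L) (hdeg : ¬ (0 < L ∧ μ ≤ L)) {θstar : Vec n}
    (hmin : ∀ x, f θstar ≤ f x) (x : Vec n) : f x = f θstar := by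
  refine le_antisymm ?_ (hmin x)
  have h := hf.sub_min_le hμ hL hmin x
  have h2 := hf.dist_sq_le hmin x
  have h3 := hf.first_order hμ x θstar
  have h4 : -⟪gradient f x, θstar - x⟫ ≤ L * ‖x - θstar‖ ^ 2 := by
    have := hL.2 x θstar
    rw [gradient_eq_zero_of_minimizer hmin, sub_zero] at this
    rw [← inner_neg_right, neg_sub]
    have h5 := real_inner_le_norm (gradient f x) (x - θstar)
    nlinarith [mul_le_mul_of_nonneg_right this (norm_nonneg (x - θstar))]
  rcases hL0.eq_or_lt with h0 | h0
  · rw [← h0] at h; linarith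
  · have hlt : L < μ := by by_contra hc; exact hdeg ⟨h0, not_lt.1 hc⟩
    -- the strong convexity inequalities between `x` and `θstar`, added up
    have h6 := hf.2 x θstar
    rw [norm_sub_rev] at h6
    have h7 : (μ - L) * ‖x - θstar‖ ^ 2 ≤ 0 := by nlinarith
    have h8 : ‖x - θstar‖ ^ 2 ≤ 0 := by
      by_contra hc
      exact absurd h7 (not_le.2 (mul_pos (sub_pos.2 hlt) (not_le.1 hc)))
    nlinarith

theorem IsLSmooth.continuous_gradient (hL : IsLSmooth L f) : Continuous (gradient f) := by
  have : LipschitzWith (Real.toNNReal L) (gradient f) := by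
    refine LipschitzWith.of_dist_le_mul fun x y => ?_
    rw [dist_eq_norm, dist_eq_norm]
    exact (hL.2 x y).trans
      (mul_le_mul_of_nonneg_right (Real.le_coe_toNNReal L) (norm_nonneg _))
  exact this.continuous

end Smooth

/-! ### Weighted averages -/

section Weighted

variable {n : ℕ} {ι : Type*} [Fintype ι]

theorem sum_weight_norm_sub_sq {α : ι → ℝ} (h1 : ∑ i, α i = 1) (z : ι → Vec n) (y : Vec n) :
    ∑ i, α i * ‖z i - y‖ ^ 2
      = ‖∑ i, α i • z i - y‖ ^ 2 + ∑ i, α i * ‖z i - ∑ j, α j • z j‖ ^ 2 := by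
  set x := ∑ j, α j • z j with hx
  have e : ∀ i, α i * ‖z i - y‖ ^ 2
      = α i * ‖z i - x‖ ^ 2 + 2 * ⟪α i • z i - α i • x, x - y⟫ + α i * ‖x - y‖ ^ 2 := by
    intro i
    have : z i - y = (z i - x) + (x - y) := by abel
    rw [this, norm_add_sq_real, ← smul_sub, real_inner_smul_left]
    ring
  have h0 : ∑ i, ⟪α i • z i - α i • x, x - y⟫ = 0 := by
    rw [← sum_inner, Finset.sum_sub_distrib, ← Finset.sum_smul, h1, one_smul, ← hx, sub_self,
      inner_zero_left]
  simp_rw [e]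
  rw [Finset.sum_add_distrib, Finset.sum_add_distrib, ← Finset.mul_sum, h0, ← Finset.sum_mul, h1]
  ring

theorem norm_sum_weight_sub_sq_le {α : ι → ℝ} (h0 : ∀ i, 0 ≤ α i) (h1 : ∑ i, α i = 1)
    (z : ι → Vec n) (y : Vec n) :
    ‖∑ i, α i • z i - y‖ ^ 2 ≤ ∑ i, α i * ‖z i - y‖ ^ 2 := by
  rw [sum_weight_norm_sub_sq h1]
  have : 0 ≤ ∑ i, α i * ‖z i - ∑ j, α j • z j‖ ^ 2 :=
    Finset.sum_nonneg fun i _ => mul_nonneg (h0 i) (sq_nonneg _)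
  linarith

/-- The variance of weighted points through their pairwise distances. -/
theorem sum_sum_weight_norm_sub_sq {α : ι → ℝ} (h1 : ∑ i, α i = 1) (z : ι → Vec n) :
    ∑ i, ∑ j, α i * α j * ‖z i - z j‖ ^ 2
      = 2 * ∑ i, α i * ‖z i - ∑ j, α j • z j‖ ^ 2 := by
  have e : ∀ i, ∑ j, α i * α j * ‖z i - z j‖ ^ 2
      = α i * ‖z i - ∑ j, α j • z j‖ ^ 2
        + α i * ∑ j, α j * ‖z j - ∑ j, α j • z j‖ ^ 2 := by
    intro i
    simp_rw [mul_assoc, ← Finset.mul_sum, norm_sub_rev (z i) (z _)]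
    rw [sum_weight_norm_sub_sq h1 z (z i), norm_sub_rev]
    ring
  simp_rw [e]
  rw [Finset.sum_add_distrib, ← Finset.sum_mul, h1]
  ring

/-- Jensen's inequality from the first-order characterization of convexity. -/
theorem IsMuStronglyConvex.map_sum_le {f : Vec n → ℝ} {μ : ℝ} (hf : IsMuStronglyConvex μ f)
    (hμ : 0 ≤ μ) {ι : Type*} (s : Finset ι) {α : ι → ℝ} (h0 : ∀ i ∈ s, 0 ≤ α i)
    (h1 : ∑ i ∈ s, α i = 1) (z : ι → Vec n) :
    f (∑ i ∈ s, α i • z i) ≤ ∑ i ∈ s, α i * f (z i) := by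
  set x := ∑ i ∈ s, α i • z i with hx
  have h := Finset.sum_le_sum fun i hi =>
    mul_le_mul_of_nonneg_left (hf.first_order hμ x (z i)) (h0 i hi)
  have e : ∑ i ∈ s, α i * (f x + ⟪gradient f x, z i - x⟫) = f x := by
    simp_rw [mul_add, ← real_inner_smul_right, smul_sub]
    rw [Finset.sum_add_distrib, ← Finset.sum_mul, h1, ← inner_sum, Finset.sum_sub_distrib,
      ← Finset.sum_smul, h1, one_smul, ← hx, sub_self, inner_zero_right]
    ring
  linarith

/-- One step of gradient descent for the average `x` of the points `z i`, along the average of the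
gradients at the `z i` instead of the gradient at `x`: the price is the variance of the `z i`. -/
theorem IsMuStronglyConvex.averaged_step {f : Vec n → ℝ} {μ L : ℝ} (hf : IsMuStronglyConvex μ f)
    (hμ : 0 ≤ μ) (hL0 : 0 < L) (hL : IsLSmooth L f) {θstar : Vec n} (hmin : ∀ x, f θstar ≤ f x)
    {γ : ℝ} (hγ : 0 ≤ γ) (hγL : γ * L ≤ 1 / 64) {α : ι → ℝ} (h0 : ∀ i, 0 ≤ α i)
    (h1 : ∑ i, α i = 1) (z : ι → Vec n) {x : Vec n} (hx : x = ∑ i, α i • z i) :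
    ‖x - γ • ∑ i, α i • gradient f (z i) - θstar‖ ^ 2
      ≤ (1 - γ * μ) * ‖x - θstar‖ ^ 2 - 3 / 2 * γ * (f x - f θstar)
        + 3 * γ * L * ∑ i, α i * ‖z i - x‖ ^ 2 := by
  set h := ∑ i, α i • gradient f (z i) with hh
  set V := ∑ i, α i * ‖z i - x‖ ^ 2 with hV
  have hV0 : 0 ≤ V := Finset.sum_nonneg fun i _ => mul_nonneg (h0 i) (sq_nonneg _)
  have hr0 : 0 ≤ f x - f θstar := sub_nonneg.2 (hmin x)
  have hin : -⟪h, x - θstar⟫ ≤ -(f x - f θstar) - μ / 2 * ‖x - θstar‖ ^ 2 + L * V := by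
    have h2 : ∀ i, α i * -⟪gradient f (z i), x - θstar⟫
        ≤ α i * (-(f x - f θstar)) - μ / 2 * (α i * ‖z i - θstar‖ ^ 2)
          + L * (α i * ‖z i - x‖ ^ 2) := by
      intro i
      have a1 := hf.2 (z i) θstar
      have a2 := hf.le_quadratic hμ hL (z i) x
      have a3 : ⟪gradient f (z i), x - θstar⟫
          = ⟪gradient f (z i), x - z i⟫ - ⟪gradient f (z i), θstar - z i⟫ := by
        rw [← inner_sub_right]; congr 1; abel
      rw [norm_sub_rev] at a1 a2
      have a4 : -⟪gradient f (z i), x - θstar⟫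
          ≤ -(f x - f θstar) - μ / 2 * ‖z i - θstar‖ ^ 2 + L * ‖z i - x‖ ^ 2 := by linarith
      have := mul_le_mul_of_nonneg_left a4 (h0 i)
      linarith
    have h3 := Finset.sum_le_sum fun i (_ : i ∈ Finset.univ) => h2 i
    rw [Finset.sum_add_distrib, Finset.sum_sub_distrib, ← Finset.mul_sum, ← Finset.mul_sum,
      ← Finset.sum_mul, h1, sum_weight_norm_sub_sq h1, ← hx] at h3
    have h4 : ∑ i, α i * -⟪gradient f (z i), x - θstar⟫ = -⟪h, x - θstar⟫ := by
      rw [hh, sum_inner, ← Finset.sum_neg_distrib]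
      exact Finset.sum_congr rfl fun i _ => by rw [real_inner_smul_left]; ring
    have h5 : 0 ≤ μ / 2 * V := by positivity
    rw [h4] at h3
    linarith
  have hsq : ‖h‖ ^ 2 ≤ 8 * L * (f x - f θstar) + 2 * L ^ 2 * V := by
    have b1 := hf.grad_sq_le hμ hL0 hL hmin x
    have b2 : ‖h - gradient f x‖ ^ 2 ≤ L ^ 2 * V := by
      refine (norm_sum_weight_sub_sq_le h0 h1 _ _).trans ?_
      rw [hV, Finset.mul_sum]
      refine Finset.sum_le_sum fun i _ => ?_
      have := pow_le_pow_left₀ (norm_nonneg _) (hL.2 (z i) x) 2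
      rw [mul_pow] at this
      have := mul_le_mul_of_nonneg_left this (h0 i)
      linarith
    have b3 : ‖h‖ ≤ ‖h - gradient f x‖ + ‖gradient f x‖ := by
      simpa using norm_add_le (h - gradient f x) (gradient f x)
    nlinarith [sq_nonneg (‖h - gradient f x‖ - ‖gradient f x‖), norm_nonneg h]
  have e : x - γ • h - θstar = (x - θstar) - γ • h := by abel
  rw [e, norm_sub_sq_real, inner_smul_right, norm_smul, mul_pow, Real.norm_eq_abs, sq_abs,
    real_inner_comm]
  have c1 := mul_le_mul_of_nonneg_left hin hγ
  have c2 := mul_le_mul_of_nonneg_left hsq (sq_nonneg γ)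
  have c3 : γ * (γ * L) * (f x - f θstar) ≤ γ * (1 / 64) * (f x - f θstar) := by gcongr
  have c4 : γ * L * (γ * L) * V ≤ γ * L * (1 / 64) * V := by gcongr
  have c5 : 0 ≤ γ * (f x - f θstar) := by positivity
  have c6 : 0 ≤ γ * L * V := by positivity
  nlinarith

end Weighted

/-! ### Conditional independence -/

section CondIndep

variable {Ω : Type*} {m m₁ m₂ : MeasurableSpace Ω} [mΩ : MeasurableSpace Ω] {Pr : Measure Ω}
  [IsProbabilityMeasure Pr]

theorem integrable_indicator_one {B : Set Ω} (hB : MeasurableSet B) :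
    Integrable (B.indicator fun _ => (1 : ℝ)) Pr :=
  (integrable_const 1).indicator hB

/-- Under conditional independence of `m₁` and `m₂` given `m`, the conditional probability of an
event of `m₂` given `m₁ ⊔ m` is its conditional probability given `m`. Both sides integrate to the
same value on the sets `A ∩ C` with `A` in `m₁` and `C` in `m`, which generate `m₁ ⊔ m`. -/
theorem CondIndepGiven.condExp_indicator_sup (h : CondIndepGiven Pr m m₁ m₂) (hm : m ≤ mΩ)
    (hm₁ : m₁ ≤ mΩ) (hm₂ : m₂ ≤ mΩ) {B : Set Ω} (hB : MeasurableSet[m₂] B) :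
    Pr⟦B | m⟧ =ᵐ[Pr] Pr⟦B | m₁ ⊔ m⟧ := by
  have hB' := hm₂ B hB
  have hle : m₁ ⊔ m ≤ mΩ := sup_le hm₁ hm
  refine ae_eq_condExp_of_forall_setIntegral_eq hle (integrable_indicator_one hB')
    (fun s _ _ => integrable_condExp.integrableOn) ?_
    (stronglyMeasurable_condExp.mono (le_sup_right : m ≤ m₁ ⊔ m)).aestronglyMeasurable
  -- compare the two finite measures on the generating π-system
  have key : ∀ A C : Set Ω, MeasurableSet[m₁] A → MeasurableSet[m] C →
      ∫ ω in A ∩ C, (Pr⟦B | m⟧) ω ∂Pr = ∫ ω in A ∩ C, B.indicator (fun _ => (1 : ℝ)) ω ∂Pr := by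
    intro A C hA hC
    have hA' := hm₁ A hA
    have hC' := hm C hC
    have hb : Pr[(A.indicator fun _ => (1 : ℝ)) * Pr⟦B | m⟧ | m] =ᵐ[Pr]
        Pr⟦A | m⟧ * Pr⟦B | m⟧ := by
      refine condExp_mul_of_stronglyMeasurable_right stronglyMeasurable_condExp ?_
        (integrable_indicator_one hA')
      have : (A.indicator fun _ => (1 : ℝ)) * Pr⟦B | m⟧ = A.indicator (Pr⟦B | m⟧) := by
        ext ω; by_cases hω : ω ∈ A <;> simp [hω]
      rw [this]
      exact integrable_condExp.indicator hA'
    have e1 : ∫ ω in A ∩ C, (Pr⟦B | m⟧) ω ∂Pr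
        = ∫ ω in C, ((A.indicator fun _ => (1 : ℝ)) * Pr⟦B | m⟧) ω ∂Pr := by
      rw [Set.inter_comm, ← setIntegral_indicator hA']
      refine setIntegral_congr_fun hC' fun ω _ => ?_
      by_cases hω : ω ∈ A <;> simp [hω]
    have e2 : ∫ ω in A ∩ C, B.indicator (fun _ => (1 : ℝ)) ω ∂Pr
        = ∫ ω in C, (A ∩ B).indicator (fun _ => (1 : ℝ)) ω ∂Pr := by
      rw [Set.inter_comm, ← setIntegral_indicator hA']
      refine setIntegral_congr_fun hC' fun ω _ => ?_
      by_cases hω : ω ∈ A <;> by_cases hω' : ω ∈ B <;> simp [hω, hω']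
    have i1 : Integrable ((A.indicator fun _ => (1 : ℝ)) * Pr⟦B | m⟧) Pr := by
      have : (A.indicator fun _ => (1 : ℝ)) * Pr⟦B | m⟧ = A.indicator (Pr⟦B | m⟧) := by
        ext ω; by_cases hω : ω ∈ A <;> simp [hω]
      rw [this]
      exact integrable_condExp.indicator hA'
    rw [e1, e2, ← setIntegral_condExp hm i1 hC,
      ← setIntegral_condExp hm (integrable_indicator_one (hA'.inter hB')) hC]
    refine setIntegral_congr_ae hC' ?_
    filter_upwards [hb, h A B hA hB] with ω h1 h2 _
    rw [h1, h2]
  intro s hs _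
  induction s, hs using MeasurableSpace.induction_on_inter
    (s := {D | ∃ A C, MeasurableSet[m₁] A ∧ MeasurableSet[m] C ∧ D = A ∩ C}) with
  | h_eq =>
    refine le_antisymm (sup_le ?_ ?_) (MeasurableSpace.generateFrom_le ?_)
    · intro A hA
      exact MeasurableSpace.measurableSet_generateFrom ⟨A, Set.univ, hA, .univ, by simp⟩
    · intro C hC
      exact MeasurableSpace.measurableSet_generateFrom ⟨Set.univ, C, .univ, hC, by simp⟩
    · rintro _ ⟨A, C, hA, hC, rfl⟩
      exact MeasurableSet.inter ((le_sup_left : m₁ ≤ m₁ ⊔ m) A hA)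
        ((le_sup_right : m ≤ m₁ ⊔ m) C hC)
  | h_inter =>
    rintro _ ⟨A, C, hA, hC, rfl⟩ _ ⟨A', C', hA', hC', rfl⟩ _
    exact ⟨A ∩ A', C ∩ C', hA.inter hA', hC.inter hC', Set.inter_inter_inter_comm _ _ _ _⟩
  | empty => simp
  | basic D hD =>
    obtain ⟨A, C, hA, hC, rfl⟩ := hD
    exact key A C hA hC
  | compl D hD ih =>
    have h1 := integral_add_compl (hle D hD) (integrable_condExp (m := m) (μ := Pr)
      (f := B.indicator fun _ => (1 : ℝ)))
    have h2 := integral_add_compl (hle D hD) (integrable_indicator_one (Pr := Pr) hB')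
    rw [integral_condExp hm] at h1
    have := ih (by simp)
    linarith
  | iUnion F hd hF ih =>
    rw [integral_iUnion (fun i => hle _ (hF i)) hd integrable_condExp.integrableOn,
      integral_iUnion (fun i => hle _ (hF i)) hd (integrable_indicator_one hB').integrableOn]
    exact tsum_congr fun i => ih i (by simp)

/-- Under conditional independence of `m₁` and `m₂` given `m ≤ m₂`, knowing `m₂` tells no more
about an `m₁ ⊔ m`-measurable variable than knowing `m`. -/
theorem CondIndepGiven.condExp_eq (h : CondIndepGiven Pr m m₁ m₂) (hmm : m ≤ m₂)
    (hm₁ : m₁ ≤ mΩ) (hm₂ : m₂ ≤ mΩ) {E : Type*} [NormedAddCommGroup E] [NormedSpace ℝ E]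
    [CompleteSpace E] {φ : Ω → E} (hφ : StronglyMeasurable[m₁ ⊔ m] φ) (hint : Integrable φ Pr) :
    Pr[φ | m₂] =ᵐ[Pr] Pr[φ | m] := by
  have hm : m ≤ mΩ := hmm.trans hm₂
  have hle : m₁ ⊔ m ≤ mΩ := sup_le hm₁ hm
  refine (ae_eq_condExp_of_forall_setIntegral_eq hm₂ hint
    (fun s _ _ => integrable_condExp.integrableOn) ?_
    (stronglyMeasurable_condExp.mono hmm).aestronglyMeasurable).symm
  intro B hB _
  have hB' := hm₂ B hB
  have ind : ∀ ψ : Ω → E, ∫ ω in B, ψ ω ∂Pr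
      = ∫ ω, ((B.indicator fun _ => (1 : ℝ)) • ψ) ω ∂Pr := by
    intro ψ
    rw [← integral_indicator hB']
    congr 1; ext ω; by_cases hω : ω ∈ B <;> simp [hω]
  have indi : ∀ ψ : Ω → E, Integrable ψ Pr →
      Integrable ((B.indicator fun _ => (1 : ℝ)) • ψ) Pr := by
    intro ψ hψ
    have : (B.indicator fun _ => (1 : ℝ)) • ψ = B.indicator ψ := by
      ext ω; by_cases hω : ω ∈ B <;> simp [hω]
    rw [this]; exact hψ.indicator hB'
  have hbd : ∀ᵐ ω ∂Pr, ‖(Pr⟦B | m⟧) ω‖ ≤ 1 := by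
    have h0 : 0 ≤ᵐ[Pr] Pr⟦B | m⟧ := condExp_nonneg
      (Filter.Eventually.of_forall fun ω => Set.indicator_nonneg (fun _ _ => zero_le_one) ω)
    have h1 : Pr⟦B | m⟧ ≤ᵐ[Pr] Pr[fun _ => (1 : ℝ) | m] := condExp_mono
      (integrable_indicator_one hB') (integrable_const 1)
      (Filter.Eventually.of_forall fun ω =>
        Set.indicator_le_self' (fun _ _ => zero_le_one) ω)
    rw [condExp_const hm] at h1
    filter_upwards [h0, h1] with ω a b
    rw [Real.norm_eq_abs, abs_of_nonneg a]; exact b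
  have ibd : ∀ ψ : Ω → E, Integrable ψ Pr → Integrable (Pr⟦B | m⟧ • ψ) Pr := fun ψ hψ =>
    hψ.bdd_smul 1 integrable_condExp.aestronglyMeasurable hbd
  calc ∫ ω in B, (Pr[φ | m]) ω ∂Pr
      = ∫ ω, (Pr[(B.indicator fun _ => (1 : ℝ)) • Pr[φ | m] | m]) ω ∂Pr := by
        rw [ind, integral_condExp hm]
    _ = ∫ ω, (Pr⟦B | m⟧ • Pr[φ | m]) ω ∂Pr := integral_congr_ae <|
        condExp_smul_of_aestronglyMeasurable_right (integrable_indicator_one hB')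
          (indi _ integrable_condExp) stronglyMeasurable_condExp.aestronglyMeasurable
    _ = ∫ ω, (Pr[Pr⟦B | m⟧ • φ | m]) ω ∂Pr := integral_congr_ae <|
        (condExp_smul_of_aestronglyMeasurable_left
          stronglyMeasurable_condExp.aestronglyMeasurable (ibd _ hint) hint).symm
    _ = ∫ ω, (Pr⟦B | m⟧ • φ) ω ∂Pr := integral_condExp hm
    _ = ∫ ω, (Pr⟦B | m₁ ⊔ m⟧ • φ) ω ∂Pr := by
        refine integral_congr_ae ?_
        filter_upwards [h.condExp_indicator_sup hm hm₁ hm₂ hB] with ω hω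
        simp only [Pi.smul_apply', hω]
    _ = ∫ ω, (Pr[(B.indicator fun _ => (1 : ℝ)) • φ | m₁ ⊔ m]) ω ∂Pr := integral_congr_ae <|
        (condExp_smul_of_aestronglyMeasurable_right (integrable_indicator_one hB')
          (indi _ hint) hφ.aestronglyMeasurable).symm
    _ = ∫ ω in B, φ ω ∂Pr := by rw [integral_condExp hle, ind]

end CondIndep

/-! ### Averages over random sets of peers -/

section Peers

variable {n N : ℕ}

/-- The indicator of `i ∈ S`, as a real number. -/
noncomputable def peerInd (S : Finset (Fin N)) (i : Fin N) : ℝ := if i ∈ S then 1 else 0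

/-- The weight of peer `i` in the average over `S`, zero for the peers outside `S`. -/
noncomputable def peerWeight (S : Finset (Fin N)) (i : Fin N) : ℝ := (S.card : ℝ)⁻¹ * peerInd S i

theorem peerInd_nonneg (S : Finset (Fin N)) (i : Fin N) : 0 ≤ peerInd S i := by
  unfold peerInd; split_ifs <;> norm_num

theorem peerInd_le_one (S : Finset (Fin N)) (i : Fin N) : peerInd S i ≤ 1 := by
  unfold peerInd; split_ifs <;> norm_num

theorem sum_peerInd (S : Finset (Fin N)) : ∑ i, peerInd S i = S.card := by
  simp [peerInd]

theorem inv_card_le_one (S : Finset (Fin N)) : (S.card : ℝ)⁻¹ ≤ 1 := Nat.cast_inv_le_one _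

theorem peerWeight_nonneg (S : Finset (Fin N)) (i : Fin N) : 0 ≤ peerWeight S i :=
  mul_nonneg (by positivity) (peerInd_nonneg S i)

theorem peerWeight_le (S : Finset (Fin N)) (i : Fin N) : peerWeight S i ≤ peerInd S i :=
  mul_le_of_le_one_left (peerInd_nonneg S i) (inv_card_le_one S)

theorem sum_peerWeight {S : Finset (Fin N)} (hS : S.Nonempty) : ∑ i, peerWeight S i = 1 := by
  unfold peerWeight
  rw [← Finset.mul_sum, sum_peerInd, inv_mul_cancel₀]
  exact_mod_cast hS.card_pos.ne'

theorem sum_peerWeight_sq (S : Finset (Fin N)) :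
    ∑ i, peerWeight S i * peerWeight S i = (S.card : ℝ)⁻¹ := by
  have h : ∀ i, peerWeight S i * peerWeight S i = (S.card : ℝ)⁻¹ ^ 2 * peerInd S i := by
    intro i; unfold peerWeight peerInd; split_ifs <;> ring
  simp_rw [h]
  rw [← Finset.mul_sum, sum_peerInd]
  by_cases h0 : (S.card : ℝ) = 0
  · simp [h0]
  · field_simp

theorem peerAvg_eq_sum (S : Finset (Fin N)) (x : Fin N → Vec n) :
    peerAvg S x = ∑ i, peerWeight S i • x i := by
  unfold peerAvg peerWeight peerInd
  rw [Finset.smul_sum]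
  simp [ite_smul]

theorem norm_peerAvg_le {S : Finset (Fin N)} {x : Fin N → Vec n} {R : ℝ} (hR : 0 ≤ R)
    (h : ∀ i ∈ S, ‖x i‖ ≤ R) : ‖peerAvg S x‖ ≤ R := by
  unfold peerAvg
  rw [norm_smul, norm_inv, Real.norm_natCast]
  have h1 : ‖∑ i ∈ S, x i‖ ≤ S.card * R := by
    simpa using norm_sum_le_of_le S h
  rcases (Nat.cast_nonneg (α := ℝ) S.card).eq_or_lt with h0 | h0
  · simp [← h0, hR]
  · rwa [inv_mul_le_iff₀ h0]

/-- The vectors produced by Moshpit All-Reduce are iterated averages of the input vectors, so they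
stay in every ball around the origin that contains the input vectors. -/
theorem IsMoshpitAllReduce.norm_le {d M T : ℕ} {S : Finset (Fin N)} {x y : Fin N → Vec n}
    (h : IsMoshpitAllReduce d M T S x y) {R : ℝ} (hR : 0 ≤ R) (hx : ∀ i ∈ S, ‖x i‖ ≤ R) :
    ∀ i ∈ S, ‖y i‖ ≤ R := by
  obtain ⟨v, A, c, h0, hstep, hT⟩ := h
  have key : ∀ t ≤ T, ∀ i ∈ S, ‖v t i‖ ≤ R := by
    intro t
    induction t with
    | zero => intro _ i hi; rw [h0 i hi]; exact hx i hi
    | succ t ih =>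
      intro ht i hi
      obtain ⟨hA, h1, h2, -⟩ := hstep t (by omega)
      by_cases hiA : i ∈ A t
      · rw [h1 i hiA]
        exact norm_peerAvg_le hR fun j hj =>
          ih (by omega) j (hA (Finset.mem_of_mem_filter j hj))
      · rw [h2 i (by simp [hi, hiA])]
        exact ih (by omega) i hi
  intro i hi
  rw [hT i hi]
  exact key T le_rfl i hi

theorem Measurable.of_peers {Ω β : Type*} {_ : MeasurableSpace Ω} [MeasurableSpace β]
    {P : Ω → Finset (Fin N)} (hP : Measurable[_, ⊤] P) (F : Finset (Fin N) → β) :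
    Measurable fun ω => F (P ω) :=
  (@measurable_from_top _ _ _ F).comp hP

end Peers

theorem MeasureTheory.MemLp.integrable_inner_vec {Ω : Type*} [MeasurableSpace Ω]
    {Pr : Measure Ω} {n : ℕ} {u v : Ω → Vec n} (hu : MemLp u 2 Pr) (hv : MemLp v 2 Pr) :
    Integrable (fun ω => ⟪u ω, v ω⟫) Pr := by
  refine (hu.integrable_norm_pow two_ne_zero |>.add
    (hv.integrable_norm_pow two_ne_zero)).mono'
    (hu.aestronglyMeasurable.inner hv.aestronglyMeasurable)
    (Filter.Eventually.of_forall fun ω => ?_)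
  refine (norm_inner_le_norm _ _).trans ?_
  simp only [Pi.add_apply]
  nlinarith [sq_nonneg (‖u ω‖ - ‖v ω‖), norm_nonneg (u ω), norm_nonneg (v ω)]

/-! ### The gradient noise -/

namespace MoshpitRun

variable {Ω : Type*} [mΩ : MeasurableSpace Ω] {n N : ℕ} (X : MoshpitRun Ω n N)

/-- The deviation of the stochastic gradient from the gradient. -/
noncomputable def noise (f : Vec n → ℝ) (k : ℕ) (i : Fin N) (ω : Ω) : Vec n :=
  X.g k i ω - gradient f (X.θ k i ω)

/-- Everything that the stochastic gradient of peer `i` in iteration `k` is conditionally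
independent of: the history and the gradients of the other peers. -/
abbrev rest (k : ℕ) (i : Fin N) : MeasurableSpace Ω :=
  X.history k ⊔ ⨆ j, ⨆ _ : j ≠ i, MeasurableSpace.comap (X.g k j) inferInstance

theorem history_le (k : ℕ) : X.history k ≤ mΩ := by
  refine sup_le (sup_le (iSup₂_le fun l _ => ?_) (iSup₂_le fun l _ => iSup_le fun i => ?_))
    (iSup₂_le fun l _ => iSup_le fun i => ?_)
  · exact (X.measurable_P l).comap_le
  · exact (X.measurable_θ l i).comap_le
  · exact (X.measurable_g l i).comap_le

theorem rest_le (k : ℕ) (i : Fin N) : X.rest k i ≤ mΩ :=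
  sup_le (X.history_le k) (iSup₂_le fun j _ => (X.measurable_g k j).comap_le)

theorem measurable_P_history {l k : ℕ} (h : l ≤ k) : Measurable[X.history k, ⊤] (X.P l) := by
  refine measurable_iff_comap_le.2 (le_trans ?_ (le_trans le_sup_left le_sup_left))
  exact le_iSup₂_of_le l h le_rfl

theorem atPoint_le_history (k : ℕ) (i : Fin N) : X.atPoint k i ≤ X.history k := by
  refine le_trans ?_ (le_trans le_sup_right le_sup_left)
  exact le_iSup₂_of_le k le_rfl (le_iSup_of_le i le_rfl)

theorem measurable_θ_history (k : ℕ) (i : Fin N) : Measurable[X.history k] (X.θ k i) :=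
  measurable_iff_comap_le.2 (X.atPoint_le_history k i)

theorem measurable_g_rest (k : ℕ) {i j : Fin N} (h : j ≠ i) : Measurable[X.rest k i] (X.g k j) :=
  measurable_iff_comap_le.2 (le_trans (le_iSup₂_of_le j h le_rfl) le_sup_right)

theorem mean_eq (k : ℕ) (ω : Ω) : X.mean k ω = ∑ i, peerWeight (X.P k ω) i • X.θ k i ω :=
  peerAvg_eq_sum _ _

section

variable {X} {Pr : Measure Ω} {f : Vec n → ℝ} {L σ : ℝ}

theorem measurable_noise (hL : IsLSmooth L f) (k : ℕ) (i : Fin N) :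
    Measurable (X.noise f k i) :=
  (X.measurable_g k i).sub (hL.continuous_gradient.measurable.comp (X.measurable_θ k i))

theorem measurable_noise_rest (hL : IsLSmooth L f) (k : ℕ) {i j : Fin N} (h : j ≠ i) :
    Measurable[X.rest k i] (X.noise f k j) :=
  (X.measurable_g_rest k h).sub (hL.continuous_gradient.measurable.comp
    ((X.measurable_θ_history k j).mono le_sup_left le_rfl))

namespace BoundedVariance

theorem integrable_noise (hv : X.BoundedVariance Pr f σ) (k : ℕ) (i : Fin N) :
    Integrable (X.noise f k i) Pr :=
  (hv.integrable k i).sub (integrable_condExp.congr (hv.unbiased k i))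

theorem memLp_noise (hv : X.BoundedVariance Pr f σ) (hL : IsLSmooth L f) (k : ℕ) (i : Fin N) :
    MemLp (X.noise f k i) 2 Pr :=
  (memLp_two_iff_integrable_sq_norm (measurable_noise hL k i).aestronglyMeasurable).2
    (hv.square_integrable k i)

theorem measurable_noise_sup (hL : IsLSmooth L f) (k : ℕ) (i : Fin N) :
    Measurable[MeasurableSpace.comap (X.g k i) inferInstance ⊔ X.atPoint k i] (X.noise f k i) :=
  Measurable.sub (measurable_iff_comap_le.2 le_sup_left)
    (hL.continuous_gradient.measurable.comp (measurable_iff_comap_le.2 le_sup_right))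

theorem condExp_noise [IsProbabilityMeasure Pr] (hv : X.BoundedVariance Pr f σ) (hL : IsLSmooth L f) (k : ℕ)
    (i : Fin N) : Pr[X.noise f k i | X.rest k i] =ᵐ[Pr] 0 := by
  have hm : X.atPoint k i ≤ X.rest k i := (X.atPoint_le_history k i).trans le_sup_left
  have hm' := hm.trans (X.rest_le k i)
  have h1 := (hv.independent k i).condExp_eq hm (X.measurable_g k i).comap_le (X.rest_le k i)
    (measurable_noise_sup hL k i).stronglyMeasurable (hv.integrable_noise k i)
  have hgrad : StronglyMeasurable[X.atPoint k i] fun ω => gradient f (X.θ k i ω) :=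
    (hL.continuous_gradient.measurable.comp
      (measurable_iff_comap_le.2 le_rfl)).stronglyMeasurable
  have hgi : Integrable (fun ω => gradient f (X.θ k i ω)) Pr :=
    integrable_condExp.congr (hv.unbiased k i)
  have h2 := condExp_sub (hv.integrable k i) hgi (X.atPoint k i)
  rw [condExp_of_stronglyMeasurable hm' hgrad hgi] at h2
  filter_upwards [h1, h2, hv.unbiased k i] with ω a b c
  rw [a]
  refine b.trans ?_
  rw [Pi.sub_apply, c, sub_self]
  rfl

theorem condExp_noise_sq_le [IsProbabilityMeasure Pr] (hv : X.BoundedVariance Pr f σ) (hL : IsLSmooth L f) (k : ℕ)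
    (i : Fin N) :
    Pr[fun ω => ‖X.noise f k i ω‖ ^ 2 | X.rest k i] ≤ᵐ[Pr] fun _ => σ ^ 2 := by
  have hm : X.atPoint k i ≤ X.rest k i := (X.atPoint_le_history k i).trans le_sup_left
  have h1 := (hv.independent k i).condExp_eq hm (X.measurable_g k i).comap_le (X.rest_le k i)
    (φ := fun ω => ‖X.noise f k i ω‖ ^ 2)
    ((continuous_norm.pow 2).measurable.comp (measurable_noise_sup hL k i)).stronglyMeasurable
    (hv.square_integrable k i)
  filter_upwards [h1, hv.variance_le k i] with ω a b
  rw [a]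
  exact b

theorem integral_inner_noise [IsProbabilityMeasure Pr] (hv : X.BoundedVariance Pr f σ) (hL : IsLSmooth L f) (k : ℕ)
    (i : Fin N) {Y : Ω → Vec n} (hY : Measurable[X.rest k i] Y) (hY2 : MemLp Y 2 Pr) :
    ∫ ω, ⟪X.noise f k i ω, Y ω⟫ ∂Pr = 0 := by
  have hint : Integrable (fun ω => ⟪X.noise f k i ω, Y ω⟫) Pr :=
    (hv.memLp_noise hL k i).integrable_inner_vec hY2
  have h1 := condExp_bilin_of_stronglyMeasurable_right (innerSL ℝ) hY.stronglyMeasurable hint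
    (hv.integrable_noise k i)
  rw [← integral_condExp (X.rest_le k i)]
  refine integral_eq_zero_of_ae ?_
  filter_upwards [h1, hv.condExp_noise hL k i] with ω a b
  refine a.trans ?_
  rw [b]
  simp

theorem integral_mul_noise_sq_le [IsProbabilityMeasure Pr] (hv : X.BoundedVariance Pr f σ) (hL : IsLSmooth L f) (k : ℕ)
    (i : Fin N) {h : Ω → ℝ} (hh : Measurable[X.rest k i] h) (h0 : ∀ ω, 0 ≤ h ω)
    (h1 : ∀ ω, h ω ≤ 1) :
    ∫ ω, h ω * ‖X.noise f k i ω‖ ^ 2 ∂Pr ≤ σ ^ 2 * ∫ ω, h ω ∂Pr := by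
  have hm := X.rest_le k i
  have hb : ∀ᵐ ω ∂Pr, ‖h ω‖ ≤ 1 := Filter.Eventually.of_forall fun ω => by
    rw [Real.norm_eq_abs, abs_of_nonneg (h0 ω)]; exact h1 ω
  have hh' : Measurable h := hh.mono hm le_rfl
  have e := condExp_stronglyMeasurable_mul_of_bound hm hh.stronglyMeasurable
    (hv.square_integrable k i) 1 hb
  rw [← integral_const_mul]
  calc ∫ ω, h ω * ‖X.noise f k i ω‖ ^ 2 ∂Pr
      = ∫ ω, (Pr[h * fun ω => ‖X.noise f k i ω‖ ^ 2 | X.rest k i]) ω ∂Pr :=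
        (integral_condExp hm).symm
    _ ≤ ∫ ω, σ ^ 2 * h ω ∂Pr := by
        refine integral_mono_ae integrable_condExp
          ((Integrable.of_bound hh'.aestronglyMeasurable 1 hb).const_mul _) ?_
        filter_upwards [e, hv.condExp_noise_sq_le hL k i] with ω a b
        refine a.le.trans ?_
        rw [Pi.mul_apply, mul_comm]
        exact mul_le_mul_of_nonneg_right b (h0 ω)

end BoundedVariance

end

end MoshpitRun

/-! ### Square integrability of the iterates -/

theorem MeasureTheory.MemLp.smul_of_abs_le {Ω : Type*} [MeasurableSpace Ω] {Pr : Measure Ω} {n : ℕ}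
    {b c : Ω → ℝ} {Z : Ω → Vec n} (hbZ : MemLp (fun ω => b ω • Z ω) 2 Pr) (hZ : Measurable Z)
    (hc : Measurable c) (h : ∀ ω, |c ω| ≤ |b ω|) : MemLp (fun ω => c ω • Z ω) 2 Pr := by
  refine hbZ.mono (hc.smul hZ).aestronglyMeasurable (Filter.Eventually.of_forall fun ω => ?_)
  rw [norm_smul, norm_smul]
  exact mul_le_mul_of_nonneg_right (h ω) (norm_nonneg _)

/-- The weight of a pair of peers of `S`, normalized by the number of peers in `S₀`; it is zero
unless both peers belong to `S`. -/
noncomputable def pairWeight {N : ℕ} (S₀ S : Finset (Fin N)) (i j : Fin N) : ℝ :=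
  (S₀.card : ℝ)⁻¹ * (peerInd S i * peerInd S j)

theorem pairWeight_nonneg {N : ℕ} (S₀ S : Finset (Fin N)) (i j : Fin N) :
    0 ≤ pairWeight S₀ S i j :=
  mul_nonneg (by positivity) (mul_nonneg (peerInd_nonneg _ _) (peerInd_nonneg _ _))

theorem pairWeight_le_left {N : ℕ} (S₀ S : Finset (Fin N)) (i j : Fin N) :
    pairWeight S₀ S i j ≤ peerInd S i := by
  refine (mul_le_of_le_one_left (mul_nonneg (peerInd_nonneg _ _) (peerInd_nonneg _ _))
    (inv_card_le_one S₀)).trans ?_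
  exact mul_le_of_le_one_right (peerInd_nonneg _ _) (peerInd_le_one _ _)

theorem pairWeight_le_right {N : ℕ} (S₀ S : Finset (Fin N)) (i j : Fin N) :
    pairWeight S₀ S i j ≤ peerInd S j := by
  refine (mul_le_of_le_one_left (mul_nonneg (peerInd_nonneg _ _) (peerInd_nonneg _ _))
    (inv_card_le_one S₀)).trans ?_
  exact mul_le_of_le_one_left (peerInd_nonneg _ _) (peerInd_le_one _ _)

theorem sum_pairWeight_sq_le {N : ℕ} {S₀ S : Finset (Fin N)} (h : S ⊆ S₀) :
    ∑ i, ∑ j, pairWeight S₀ S i j * pairWeight S₀ S i j ≤ 1 := by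
  have e : ∀ i j, pairWeight S₀ S i j * pairWeight S₀ S i j
      = (S₀.card : ℝ)⁻¹ ^ 2 * (peerInd S i * peerInd S j) := by
    intro i j; unfold pairWeight peerInd; split_ifs <;> ring
  simp_rw [e, ← Finset.mul_sum, ← Finset.sum_mul]
  rw [sum_peerInd, ← sq, ← mul_pow]
  refine pow_le_one₀ (by positivity) ?_
  rw [inv_mul_eq_div]
  exact div_le_one_of_le₀ (by exact_mod_cast Finset.card_le_card h) (by positivity)

namespace MoshpitRun

variable {Ω : Type*} [mΩ : MeasurableSpace Ω] {n N : ℕ}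

/-- The hypotheses of the convergence theorem, in the nondegenerate case `0 < L`, `μ ≤ L` and
for stepsizes up to `1 / (64 L)`. -/
structure Admissible (X : MoshpitRun Ω n N) (Pr : Measure Ω) (f : Vec n → ℝ)
    (μ L σ δpv₁ δpv₂ δaq γ : ℝ) (τ Nmin d M T : ℕ) (θ₀ θstar : Vec n) : Prop where
  convex : IsMuStronglyConvex μ f
  smooth : IsLSmooth L f
  isMin : ∀ x, f θstar ≤ f x
  μ_nonneg : 0 ≤ μ
  L_pos : 0 < L
  μ_le_L : μ ≤ L
  γ_pos : 0 < γ
  γ_mul_L : γ * L ≤ 1 / 64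
  τ_pos : 1 ≤ τ
  Nmin_pos : 1 ≤ Nmin
  run : X.IsMoshpitSGD d M T θ₀ γ τ
  var : X.BoundedVariance Pr f σ
  avg : X.AveragingQuality Pr γ μ δpv₁ δpv₂ δaq τ Nmin θstar

namespace Admissible

variable {X : MoshpitRun Ω n N} {Pr : Measure Ω} [IsProbabilityMeasure Pr] {f : Vec n → ℝ}
  {μ L σ δpv₁ δpv₂ δaq γ : ℝ} {τ Nmin d M T : ℕ} {θ₀ θstar : Vec n}

omit [IsProbabilityMeasure Pr] in
theorem peers_subset (h : X.Admissible Pr f μ L σ δpv₁ δpv₂ δaq γ τ Nmin d M T θ₀ θstar)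
    {l k : ℕ} (hlk : l ≤ k) (ω : Ω) : X.P k ω ⊆ X.P l ω :=
  antitone_nat_of_succ_le (f := fun k => X.P k ω) (fun k => h.avg.peers_antitone k ω) hlk

omit [IsProbabilityMeasure Pr] in
theorem peers_nonempty (h : X.Admissible Pr f μ L σ δpv₁ δpv₂ δaq γ τ Nmin d M T θ₀ θstar)
    (k : ℕ) (ω : Ω) : (X.P k ω).Nonempty :=
  Finset.card_pos.1 (h.Nmin_pos.trans (h.avg.le_card_peers k ω))

omit [IsProbabilityMeasure Pr] in
theorem measurable_grad (h : X.Admissible Pr f μ L σ δpv₁ δpv₂ δaq γ τ Nmin d M T θ₀ θstar)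
    (k : ℕ) (i : Fin N) : Measurable fun ω => gradient f (X.θ k i ω) :=
  h.smooth.continuous_gradient.measurable.comp (X.measurable_θ k i)

theorem memLp_grad_of_point
    (h : X.Admissible Pr f μ L σ δpv₁ δpv₂ δaq γ τ Nmin d M T θ₀ θstar) {k : ℕ} {i : Fin N}
    (hθ : MemLp (fun ω => peerInd (X.P k ω) i • X.θ k i ω) 2 Pr) :
    MemLp (fun ω => peerInd (X.P k ω) i • gradient f (X.θ k i ω)) 2 Pr := by
  refine MemLp.mono' ((hθ.norm.const_mul L).add (memLp_const (L * ‖θstar‖)))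
    (((X.measurable_P k).of_peers fun S => peerInd S i).smul
      (h.measurable_grad k i)).aestronglyMeasurable
    (Filter.Eventually.of_forall fun ω => ?_)
  have h1 := h.smooth.2 (X.θ k i ω) θstar
  rw [gradient_eq_zero_of_minimizer h.isMin, sub_zero] at h1
  have h2 := norm_sub_le (X.θ k i ω) θstar
  have hp := peerInd_nonneg (X.P k ω) i
  have hL := h.L_pos
  simp only [Pi.add_apply, norm_smul, Real.norm_eq_abs, abs_of_nonneg hp]
  calc peerInd (X.P k ω) i * ‖gradient f (X.θ k i ω)‖
      ≤ peerInd (X.P k ω) i * (L * (‖X.θ k i ω‖ + ‖θstar‖)) := by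
        gcongr; exact h1.trans (by gcongr)
    _ = L * (peerInd (X.P k ω) i * ‖X.θ k i ω‖) + peerInd (X.P k ω) i * (L * ‖θstar‖) := by ring
    _ ≤ _ := add_le_add le_rfl
        (mul_le_of_le_one_left (mul_nonneg hL.le (norm_nonneg _)) (peerInd_le_one _ _))

omit [IsProbabilityMeasure Pr] in
theorem memLp_noise_smul (h : X.Admissible Pr f μ L σ δpv₁ δpv₂ δaq γ τ Nmin d M T θ₀ θstar)
    (k : ℕ) (i : Fin N) {c : Ω → ℝ} (hc : Measurable c) (hc1 : ∀ ω, |c ω| ≤ 1) :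
    MemLp (fun ω => c ω • X.noise f k i ω) 2 Pr := by
  refine MemLp.smul_of_abs_le (b := fun _ => 1) ?_ (measurable_noise h.smooth k i) hc (by simpa)
  simpa using h.var.memLp_noise h.smooth k i

/-- The iterates of the participating peers are square integrable. (Nothing is assumed about the
iterates of the peers that have left.) -/
theorem memLp_point (h : X.Admissible Pr f μ L σ δpv₁ δpv₂ δaq γ τ Nmin d M T θ₀ θstar)
    (k : ℕ) (i : Fin N) : MemLp (fun ω => peerInd (X.P k ω) i • X.θ k i ω) 2 Pr := by
  induction k generalizing i with
  | zero =>
    have : (fun ω => peerInd (X.P 0 ω) i • X.θ 0 i ω) = fun _ => θ₀ := by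
      ext1 ω
      simp [h.run.initial_peers, h.run.initial_point, peerInd]
    rw [this]
    exact memLp_const _
  | succ k ih =>
    have hind : ∀ j, Measurable fun ω => peerInd (X.P k ω) j := fun j =>
      (X.measurable_P k).of_peers fun S => peerInd S j
    have hu : ∀ j, MemLp (fun ω => peerInd (X.P k ω) j • (X.θ k j ω - γ • X.g k j ω)) 2 Pr := by
      intro j
      have := (ih j).sub (((h.memLp_grad_of_point (ih j)).add
        (h.memLp_noise_smul k j (hind j) fun ω => by
          rw [abs_of_nonneg (peerInd_nonneg _ _)]; exact peerInd_le_one _ _)).const_smul γ)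
      refine this.congr_norm ((hind j).smul ((X.measurable_θ k j).sub
        ((X.measurable_g k j).const_smul γ))).aestronglyMeasurable
        (Filter.Eventually.of_forall fun ω => ?_)
      simp only [Pi.sub_apply, Pi.add_apply, Pi.smul_apply, noise, smul_sub,
        add_sub_cancel]
      rw [smul_comm]
    refine MemLp.mono' (memLp_finsetSum Finset.univ fun j _ => (hu j).norm)
      (((X.measurable_P (k + 1)).of_peers fun S => peerInd S i).smul
        (X.measurable_θ (k + 1) i)).aestronglyMeasurable
      (Filter.Eventually.of_forall fun ω => ?_)
    set R := ∑ j, ‖peerInd (X.P k ω) j • (X.θ k j ω - γ • X.g k j ω)‖ with hR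
    have hR0 : 0 ≤ R := Finset.sum_nonneg fun _ _ => norm_nonneg _
    have hle : ∀ j ∈ X.P (k + 1) ω, ‖X.θ k j ω - γ • X.g k j ω‖ ≤ R := by
      intro j hj
      have h1 : ‖peerInd (X.P k ω) j • (X.θ k j ω - γ • X.g k j ω)‖ ≤ R :=
        Finset.single_le_sum (f := fun j =>
          ‖peerInd (X.P k ω) j • (X.θ k j ω - γ • X.g k j ω)‖) (fun _ _ => norm_nonneg _)
          (Finset.mem_univ j)
      have h2 : peerInd (X.P k ω) j = 1 := if_pos (h.avg.peers_antitone k ω hj)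
      rwa [h2, one_smul] at h1
    by_cases hi : i ∈ X.P (k + 1) ω
    · simp only [peerInd, hi, if_true, one_smul]
      by_cases hτ : τ ∣ k + 1
      · exact (h.run.averaging_step k hτ ω).norm_le hR0 hle i hi
      · rw [h.run.local_step k hτ ω i hi]
        exact hle i hi
    · simpa [peerInd, hi] using hR0

theorem memLp_smul_point (h : X.Admissible Pr f μ L σ δpv₁ δpv₂ δaq γ τ Nmin d M T θ₀ θstar)
    (k : ℕ) (i : Fin N) {c : Ω → ℝ} (hc : Measurable c) (hc0 : ∀ ω, 0 ≤ c ω)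
    (hc1 : ∀ ω, c ω ≤ peerInd (X.P k ω) i) : MemLp (fun ω => c ω • X.θ k i ω) 2 Pr :=
  (h.memLp_point k i).smul_of_abs_le (X.measurable_θ k i) hc fun ω =>
    abs_le_abs_of_nonneg (hc0 ω) (hc1 ω)

theorem memLp_smul_grad (h : X.Admissible Pr f μ L σ δpv₁ δpv₂ δaq γ τ Nmin d M T θ₀ θstar)
    (k : ℕ) (i : Fin N) {c : Ω → ℝ} (hc : Measurable c) (hc0 : ∀ ω, 0 ≤ c ω)
    (hc1 : ∀ ω, c ω ≤ peerInd (X.P k ω) i) :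
    MemLp (fun ω => c ω • gradient f (X.θ k i ω)) 2 Pr :=
  (h.memLp_grad_of_point (h.memLp_point k i)).smul_of_abs_le (h.measurable_grad k i) hc
    fun ω => abs_le_abs_of_nonneg (hc0 ω) (hc1 ω)

omit [IsProbabilityMeasure Pr] in
theorem measurable_weight (k : ℕ) (i : Fin N) :
    Measurable fun ω => peerWeight (X.P k ω) i :=
  (X.measurable_P k).of_peers fun S => peerWeight S i

theorem memLp_mean (h : X.Admissible Pr f μ L σ δpv₁ δpv₂ δaq γ τ Nmin d M T θ₀ θstar)
    (k : ℕ) : MemLp (X.mean k) 2 Pr := by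
  have : X.mean k = fun ω => ∑ i, peerWeight (X.P k ω) i • X.θ k i ω :=
    funext fun ω => X.mean_eq k ω
  rw [this]
  exact memLp_finsetSum _ fun i _ => h.memLp_smul_point k i (measurable_weight k i)
    (fun ω => peerWeight_nonneg _ _) fun ω => peerWeight_le _ _

theorem integrable_sub_min (h : X.Admissible Pr f μ L σ δpv₁ δpv₂ δaq γ τ Nmin d M T θ₀ θstar)
    {Y : Ω → Vec n} (hY : MemLp Y 2 Pr) : Integrable (fun ω => f (Y ω) - f θstar) Pr := by
  refine (((hY.sub (memLp_const θstar)).integrable_norm_pow two_ne_zero).const_mul L).mono'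
    ((h.smooth.1.continuous.comp_aestronglyMeasurable hY.aestronglyMeasurable).sub
      aestronglyMeasurable_const) (Filter.Eventually.of_forall fun ω => ?_)
  rw [Real.norm_eq_abs, abs_of_nonneg (sub_nonneg.2 (h.isMin _))]
  exact h.convex.sub_min_le h.μ_nonneg h.smooth h.isMin _

/-! ### Drift of the local iterates -/

omit [IsProbabilityMeasure Pr] in
theorem measurable_pairWeight_history {k₀ k : ℕ} (hk : k₀ ≤ k) (i j : Fin N) :
    Measurable[X.history k] fun ω => pairWeight (X.P k₀ ω) (X.P k ω) i j :=
  Measurable.mul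
    ((X.measurable_P_history hk).of_peers fun S => (S.card : ℝ)⁻¹)
    ((X.measurable_P_history le_rfl).of_peers fun S => peerInd S i * peerInd S j)

/-- A local step of two peers increases their expected weighted squared distance only by the noise:
the gradient steps are nonexpansive and the noise is orthogonal to the history. -/
theorem pair_step (h : X.Admissible Pr f μ L σ δpv₁ δpv₂ δaq γ τ Nmin d M T θ₀ θstar)
    (k : ℕ) (i j : Fin N) {s : Ω → ℝ} (hs : Measurable[X.history k] s) (hs0 : ∀ ω, 0 ≤ s ω)
    (hsi : ∀ ω, s ω ≤ peerInd (X.P k ω) i) (hsj : ∀ ω, s ω ≤ peerInd (X.P k ω) j) :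
    ∫ ω, ‖s ω • ((X.θ k i ω - γ • X.g k i ω) - (X.θ k j ω - γ • X.g k j ω))‖ ^ 2 ∂Pr
      ≤ ∫ ω, ‖s ω • (X.θ k i ω - X.θ k j ω)‖ ^ 2 ∂Pr
        + 4 * γ ^ 2 * σ ^ 2 * ∫ ω, s ω * s ω ∂Pr := by
  have hs' : Measurable s := hs.mono (X.history_le k) le_rfl
  have hs1 : ∀ ω, s ω ≤ 1 := fun ω => (hsi ω).trans (peerInd_le_one _ _)
  have hss : ∀ ω, s ω * s ω ≤ 1 := fun ω => mul_le_one₀ (hs1 ω) (hs0 ω) (hs1 ω)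
  set Y : Ω → Vec n := fun ω => s ω • ((X.θ k i ω - γ • gradient f (X.θ k i ω))
    - (X.θ k j ω - γ • gradient f (X.θ k j ω))) with hYdef
  have hgm : ∀ i, Measurable[X.history k] fun ω => gradient f (X.θ k i ω) := fun i =>
    h.smooth.continuous_gradient.measurable.comp (X.measurable_θ_history k i)
  have hYm : Measurable[X.history k] Y := Measurable.smul hs
    (Measurable.sub
      (Measurable.sub (X.measurable_θ_history k i) (Measurable.const_smul (hgm i) γ))
      (Measurable.sub (X.measurable_θ_history k j) (Measurable.const_smul (hgm j) γ)))
  have hstep : ∀ i, (∀ ω, s ω ≤ peerInd (X.P k ω) i) →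
      MemLp (fun ω => s ω • X.θ k i ω - γ • (s ω • gradient f (X.θ k i ω))) 2 Pr := fun i hi =>
    (h.memLp_smul_point k i hs' hs0 hi).sub ((h.memLp_smul_grad k i hs' hs0 hi).const_smul γ)
  have hY2 : MemLp Y 2 Pr := by
    refine ((hstep i hsi).sub (hstep j hsj)).congr_norm
      (hYm.mono (X.history_le k) le_rfl).aestronglyMeasurable
      (Filter.Eventually.of_forall fun ω => ?_)
    simp only [hYdef, Pi.sub_apply, smul_sub, smul_comm γ]
  have hD2 : MemLp (fun ω => s ω • (X.θ k i ω - X.θ k j ω)) 2 Pr := by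
    simp_rw [smul_sub]
    exact (h.memLp_smul_point k i hs' hs0 hsi).sub (h.memLp_smul_point k j hs' hs0 hsj)
  have hsY2 : MemLp (fun ω => s ω • Y ω) 2 Pr := by
    refine MemLp.smul_of_abs_le (b := fun _ => 1) (by simpa using hY2)
      (hYm.mono (X.history_le k) le_rfl) hs' fun ω => ?_
    rw [abs_of_nonneg (hs0 ω), abs_one]; exact hs1 ω
  have hsYm : Measurable[X.history k] fun ω => s ω • Y ω := Measurable.smul hs hYm
  have hsn : ∀ i, MemLp (fun ω => s ω • X.noise f k i ω) 2 Pr := fun i =>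
    h.memLp_noise_smul k i hs' fun ω => by rw [abs_of_nonneg (hs0 ω)]; exact hs1 ω
  have hnsq : ∀ i, Integrable (fun ω => s ω * s ω * ‖X.noise f k i ω‖ ^ 2) Pr := fun i => by
    refine ((hsn i).integrable_norm_pow two_ne_zero).congr
      (Filter.Eventually.of_forall fun ω => ?_)
    simp only [norm_smul, mul_pow, Real.norm_eq_abs, sq_abs]; ring
  have hin : ∀ i, Integrable (fun ω => ⟪X.noise f k i ω, s ω • Y ω⟫) Pr := fun i =>
    (h.var.memLp_noise h.smooth k i).integrable_inner_vec hsY2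
  have hz : ∀ i, ∫ ω, ⟪X.noise f k i ω, s ω • Y ω⟫ ∂Pr = 0 := fun i =>
    h.var.integral_inner_noise h.smooth k i (hsYm.mono le_sup_left le_rfl) hsY2
  have hn : ∀ i, ∫ ω, s ω * s ω * ‖X.noise f k i ω‖ ^ 2 ∂Pr ≤ σ ^ 2 * ∫ ω, s ω * s ω ∂Pr :=
    fun i => h.var.integral_mul_noise_sq_le h.smooth k i
      ((Measurable.mul hs hs).mono le_sup_left le_rfl)
      (fun ω => mul_nonneg (hs0 ω) (hs0 ω)) hss
  have hpt : ∀ ω, ‖s ω • ((X.θ k i ω - γ • X.g k i ω) - (X.θ k j ω - γ • X.g k j ω))‖ ^ 2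
      ≤ ‖s ω • (X.θ k i ω - X.θ k j ω)‖ ^ 2
        + (2 * γ * ⟪X.noise f k j ω, s ω • Y ω⟫ - 2 * γ * ⟪X.noise f k i ω, s ω • Y ω⟫)
        + (2 * γ ^ 2 * (s ω * s ω * ‖X.noise f k i ω‖ ^ 2)
          + 2 * γ ^ 2 * (s ω * s ω * ‖X.noise f k j ω‖ ^ 2)) := by
    intro ω
    have e : s ω • ((X.θ k i ω - γ • X.g k i ω) - (X.θ k j ω - γ • X.g k j ω))
        = Y ω - γ • (s ω • (X.noise f k i ω - X.noise f k j ω)) := by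
      simp only [hYdef, noise, smul_sub, smul_comm γ]
      abel
    have hne := h.convex.gradient_step_nonexpansive h.μ_nonneg h.L_pos h.smooth h.γ_pos.le
      (h.γ_mul_L.trans (by norm_num)) (X.θ k i ω) (X.θ k j ω)
    have hY1 : ‖Y ω‖ ^ 2 ≤ ‖s ω • (X.θ k i ω - X.θ k j ω)‖ ^ 2 := by
      simp only [hYdef, norm_smul, mul_pow]
      gcongr
    have hsum : ‖X.noise f k i ω - X.noise f k j ω‖ ^ 2
        ≤ 2 * ‖X.noise f k i ω‖ ^ 2 + 2 * ‖X.noise f k j ω‖ ^ 2 := by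
      have := norm_sub_le (X.noise f k i ω) (X.noise f k j ω)
      nlinarith [sq_nonneg (‖X.noise f k i ω‖ - ‖X.noise f k j ω‖),
        norm_nonneg (X.noise f k i ω - X.noise f k j ω)]
    have hI : ⟪Y ω, s ω • (X.noise f k i ω - X.noise f k j ω)⟫
        = ⟪X.noise f k i ω, s ω • Y ω⟫ - ⟪X.noise f k j ω, s ω • Y ω⟫ := by
      rw [← inner_sub_left, real_inner_smul_right, real_inner_smul_right, real_inner_comm]
    have hE : ‖γ • s ω • (X.noise f k i ω - X.noise f k j ω)‖ ^ 2
        = γ ^ 2 * s ω ^ 2 * ‖X.noise f k i ω - X.noise f k j ω‖ ^ 2 := by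
      rw [norm_smul, norm_smul, mul_pow, mul_pow, Real.norm_eq_abs, Real.norm_eq_abs, sq_abs,
        sq_abs, mul_assoc]
    rw [e, norm_sub_sq_real, inner_smul_right, hI, hE]
    have := mul_le_mul_of_nonneg_left hsum (by positivity : 0 ≤ γ ^ 2 * s ω ^ 2)
    linarith
  have i1 := hD2.integrable_norm_pow two_ne_zero
  have i2 := ((hin j).const_mul (2 * γ)).sub ((hin i).const_mul (2 * γ))
  have i3 := ((hnsq i).const_mul (2 * γ ^ 2)).add ((hnsq j).const_mul (2 * γ ^ 2))
  refine (integral_mono_of_nonneg (Filter.Eventually.of_forall fun ω => sq_nonneg _)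
    ((i1.add i2).add i3) (Filter.Eventually.of_forall hpt)).trans ?_
  rw [integral_add' (i1.add i2) i3, integral_add' i1 i2,
    integral_sub' ((hin j).const_mul (2 * γ)) ((hin i).const_mul (2 * γ)),
    integral_add' ((hnsq i).const_mul (2 * γ ^ 2)) ((hnsq j).const_mul (2 * γ ^ 2)),
    integral_const_mul, integral_const_mul, integral_const_mul, integral_const_mul, hz i, hz j]
  have a1 := mul_le_mul_of_nonneg_left (hn i) (by positivity : 0 ≤ 2 * γ ^ 2)
  have a2 := mul_le_mul_of_nonneg_left (hn j) (by positivity : 0 ≤ 2 * γ ^ 2)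
  linarith

/-- The pairwise dispersion of the participating iterates in iteration `k`, normalized by the
number of peers in iteration `k₀`. Unlike the variance of the iterates, it cannot grow when peers
leave. -/
noncomputable def _root_.MoshpitRun.dispersion (X : MoshpitRun Ω n N) (k₀ k : ℕ) (ω : Ω) : ℝ :=
  ∑ i, ∑ j, ‖pairWeight (X.P k₀ ω) (X.P k ω) i j • (X.θ k i ω - X.θ k j ω)‖ ^ 2

omit [IsProbabilityMeasure Pr] in
theorem measurable_pairWeight (k₀ k : ℕ) (i j : Fin N) :
    Measurable fun ω => pairWeight (X.P k₀ ω) (X.P k ω) i j :=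
  Measurable.mul ((X.measurable_P k₀).of_peers fun S => (S.card : ℝ)⁻¹)
    ((X.measurable_P k).of_peers fun S => peerInd S i * peerInd S j)

theorem integrable_pair (h : X.Admissible Pr f μ L σ δpv₁ δpv₂ δaq γ τ Nmin d M T θ₀ θstar)
    (k₀ k : ℕ) (i j : Fin N) :
    Integrable (fun ω => ‖pairWeight (X.P k₀ ω) (X.P k ω) i j • (X.θ k i ω - X.θ k j ω)‖ ^ 2)
      Pr := by
  refine MemLp.integrable_norm_pow ?_ two_ne_zero
  simp_rw [smul_sub]
  exact (h.memLp_smul_point k i (measurable_pairWeight k₀ k i j)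
      (fun ω => pairWeight_nonneg _ _ _ _) fun ω => pairWeight_le_left _ _ _ _).sub
    (h.memLp_smul_point k j (measurable_pairWeight k₀ k i j)
      (fun ω => pairWeight_nonneg _ _ _ _) fun ω => pairWeight_le_right _ _ _ _)

theorem integrable_dispersion
    (h : X.Admissible Pr f μ L σ δpv₁ δpv₂ δaq γ τ Nmin d M T θ₀ θstar) (k₀ k : ℕ) :
    Integrable (X.dispersion k₀ k) Pr :=
  integrable_finsetSum _ fun i _ => integrable_finsetSum _ fun j _ => h.integrable_pair k₀ k i j

theorem integral_dispersion_succ_le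
    (h : X.Admissible Pr f μ L σ δpv₁ δpv₂ δaq γ τ Nmin d M T θ₀ θstar) {k₀ k : ℕ}
    (hk : k₀ ≤ k) (hτ : ¬ τ ∣ k + 1) :
    ∫ ω, X.dispersion k₀ (k + 1) ω ∂Pr
      ≤ ∫ ω, X.dispersion k₀ k ω ∂Pr + 4 * γ ^ 2 * σ ^ 2 := by
  set s : Fin N → Fin N → Ω → ℝ := fun i j ω => pairWeight (X.P k₀ ω) (X.P k ω) i j with hs
  have hss : ∀ i j, Integrable (fun ω => s i j ω * s i j ω) Pr := by
    intro i j
    refine Integrable.of_bound ((measurable_pairWeight k₀ k i j).mul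
      (measurable_pairWeight k₀ k i j)).aestronglyMeasurable 1
      (Filter.Eventually.of_forall fun ω => ?_)
    have h0 := pairWeight_nonneg (X.P k₀ ω) (X.P k ω) i j
    have h1 := (pairWeight_le_left (X.P k₀ ω) (X.P k ω) i j).trans (peerInd_le_one _ _)
    rw [Real.norm_eq_abs, abs_of_nonneg (mul_nonneg h0 h0)]
    exact mul_le_one₀ h1 h0 h1
  have hij : ∀ i j,
      ∫ ω, ‖pairWeight (X.P k₀ ω) (X.P (k + 1) ω) i j
          • (X.θ (k + 1) i ω - X.θ (k + 1) j ω)‖ ^ 2 ∂Pr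
        ≤ ∫ ω, ‖s i j ω • (X.θ k i ω - X.θ k j ω)‖ ^ 2 ∂Pr
          + 4 * γ ^ 2 * σ ^ 2 * ∫ ω, s i j ω * s i j ω ∂Pr := by
    intro i j
    refine le_trans ?_ (h.pair_step k i j (measurable_pairWeight_history hk i j)
      (fun ω => pairWeight_nonneg _ _ _ _) (fun ω => pairWeight_le_left _ _ _ _)
      fun ω => pairWeight_le_right _ _ _ _)
    have hu : ∀ i (c : Ω → ℝ), Measurable c → (∀ ω, 0 ≤ c ω) →
        (∀ ω, c ω ≤ peerInd (X.P k ω) i) →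
        MemLp (fun ω => c ω • X.θ k i ω
          - γ • (c ω • gradient f (X.θ k i ω) + c ω • X.noise f k i ω)) 2 Pr :=
      fun i c hc hc0 hc1 => (h.memLp_smul_point k i hc hc0 hc1).sub
        (((h.memLp_smul_grad k i hc hc0 hc1).add (h.memLp_noise_smul k i hc fun ω => by
          rw [abs_of_nonneg (hc0 ω)]; exact (hc1 ω).trans (peerInd_le_one _ _))).const_smul γ)
    have hint : Integrable (fun ω => ‖pairWeight (X.P k₀ ω) (X.P k ω) i j
        • ((X.θ k i ω - γ • X.g k i ω) - (X.θ k j ω - γ • X.g k j ω))‖ ^ 2) Pr := by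
      refine (((hu i _ (measurable_pairWeight k₀ k i j) (fun ω => pairWeight_nonneg _ _ _ _)
        fun ω => pairWeight_le_left _ _ _ _).sub
        (hu j _ (measurable_pairWeight k₀ k i j) (fun ω => pairWeight_nonneg _ _ _ _)
        fun ω => pairWeight_le_right _ _ _ _)).integrable_norm_pow two_ne_zero).congr
        (Filter.Eventually.of_forall fun ω => ?_)
      simp only [Pi.sub_apply, noise, ← smul_add, add_sub_cancel]
      congr 2
      simp only [smul_sub, smul_comm γ]
    refine integral_mono_of_nonneg (Filter.Eventually.of_forall fun ω => sq_nonneg _) hint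
      (Filter.Eventually.of_forall fun ω => ?_)
    change ‖_‖ ^ 2 ≤ ‖_‖ ^ 2
    by_cases hij : i ∈ X.P (k + 1) ω ∧ j ∈ X.P (k + 1) ω
    · obtain ⟨hi, hj⟩ := hij
      rw [h.run.local_step k hτ ω i hi, h.run.local_step k hτ ω j hj]
      simp [hs, pairWeight, peerInd, hi, hj, h.avg.peers_antitone k ω hi,
        h.avg.peers_antitone k ω hj]
    · have h0 : pairWeight (X.P k₀ ω) (X.P (k + 1) ω) i j = 0 := by
        rcases not_and_or.1 hij with hi | hj
        · simp [pairWeight, peerInd, hi]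
        · simp [pairWeight, peerInd, hj]
      rw [h0, zero_smul, norm_zero, zero_pow two_ne_zero]
      exact sq_nonneg _
  have e1 : ∀ k, ∫ ω, X.dispersion k₀ k ω ∂Pr = ∑ i, ∑ j,
      ∫ ω, ‖pairWeight (X.P k₀ ω) (X.P k ω) i j • (X.θ k i ω - X.θ k j ω)‖ ^ 2 ∂Pr := by
    intro k
    unfold MoshpitRun.dispersion
    rw [integral_finsetSum _ fun i _ => integrable_finsetSum _ fun j _ =>
      h.integrable_pair k₀ k i j]
    exact Finset.sum_congr rfl fun i _ => integral_finsetSum _ fun j _ =>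
      h.integrable_pair k₀ k i j
  have e2 : ∑ i, ∑ j, ∫ ω, s i j ω * s i j ω ∂Pr ≤ 1 := by
    have : ∑ i, ∑ j, ∫ ω, s i j ω * s i j ω ∂Pr = ∫ ω, ∑ i, ∑ j, s i j ω * s i j ω ∂Pr := by
      rw [integral_finsetSum _ fun i _ => integrable_finsetSum _ fun j _ => hss i j]
      exact Finset.sum_congr rfl fun i _ => (integral_finsetSum _ fun j _ => hss i j).symm
    rw [this]
    calc ∫ ω, ∑ i, ∑ j, s i j ω * s i j ω ∂Pr ≤ ∫ _, (1 : ℝ) ∂Pr :=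
          integral_mono (integrable_finsetSum _ fun i _ => integrable_finsetSum _ fun j _ =>
            hss i j) (integrable_const 1) fun ω => sum_pairWeight_sq_le (h.peers_subset hk ω)
      _ = 1 := by simp
  rw [e1, e1]
  refine (Finset.sum_le_sum fun i _ => Finset.sum_le_sum fun j _ => hij i j).trans ?_
  simp_rw [Finset.sum_add_distrib, ← Finset.mul_sum]
  have := mul_le_mul_of_nonneg_left e2 (by positivity : 0 ≤ 4 * γ ^ 2 * σ ^ 2)
  rw [mul_one] at this
  gcongr

omit [IsProbabilityMeasure Pr] in
theorem dispersion_self (h : X.Admissible Pr f μ L σ δpv₁ δpv₂ δaq γ τ Nmin d M T θ₀ θstar)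
    (k : ℕ) (ω : Ω) : X.dispersion k k ω
      = 2 * (((X.P k ω).card : ℝ)⁻¹ * ∑ i ∈ X.P k ω, ‖X.θ k i ω - X.mean k ω‖ ^ 2) := by
  have e0 : ∀ i j, ‖pairWeight (X.P k ω) (X.P k ω) i j • (X.θ k i ω - X.θ k j ω)‖ ^ 2
      = peerWeight (X.P k ω) i * peerWeight (X.P k ω) j * ‖X.θ k i ω - X.θ k j ω‖ ^ 2 := by
    intro i j
    rw [norm_smul, mul_pow, Real.norm_eq_abs, sq_abs]
    congr 1
    unfold pairWeight peerWeight peerInd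
    split_ifs <;> ring
  unfold MoshpitRun.dispersion
  simp_rw [e0]
  rw [sum_sum_weight_norm_sub_sq (sum_peerWeight (h.peers_nonempty k ω)), ← X.mean_eq]
  congr 1
  simp_rw [peerWeight, mul_assoc, ← Finset.mul_sum]
  simp [peerInd]

omit [IsProbabilityMeasure Pr] in
/-- Inside a period at least half of the peers survive, so that the variance of the iterates is at
most twice their dispersion. -/
theorem variance_le_dispersion
    (h : X.Admissible Pr f μ L σ δpv₁ δpv₂ δaq γ τ Nmin d M T θ₀ θstar)
    {a k : ℕ} (hk : k ≤ (a + 1) * τ) (ω : Ω) :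
    ∑ i, peerWeight (X.P k ω) i * ‖X.θ k i ω - X.mean k ω‖ ^ 2
      ≤ 2 * X.dispersion (a * τ) k ω := by
  have h1 := sum_sum_weight_norm_sub_sq (sum_peerWeight (h.peers_nonempty k ω))
    fun i => X.θ k i ω
  rw [← X.mean_eq] at h1
  have hcard : (X.P (a * τ) ω).card ≤ 2 * (X.P k ω).card :=
    (h.avg.card_peers_le a ω).trans
      (Nat.mul_le_mul_left 2 (Finset.card_le_card (h.peers_subset hk ω)))
  have hpos : (0 : ℝ) < (X.P (a * τ) ω).card := by
    exact_mod_cast (h.peers_nonempty _ ω).card_pos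
  have hinv : ((X.P k ω).card : ℝ)⁻¹ ≤ 2 * ((X.P (a * τ) ω).card : ℝ)⁻¹ := by
    have hpos' : (0 : ℝ) < (X.P k ω).card := by exact_mod_cast (h.peers_nonempty k ω).card_pos
    have : ((X.P (a * τ) ω).card : ℝ) ≤ 2 * (X.P k ω).card := by exact_mod_cast hcard
    rw [← div_eq_mul_inv, inv_le_comm₀ hpos' (by positivity), inv_div, div_le_iff₀ two_pos]
    linarith
  have h2 : ∑ i, ∑ j, peerWeight (X.P k ω) i * peerWeight (X.P k ω) j
        * ‖X.θ k i ω - X.θ k j ω‖ ^ 2 ≤ 4 * X.dispersion (a * τ) k ω := by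
    unfold MoshpitRun.dispersion
    rw [Finset.mul_sum]
    refine Finset.sum_le_sum fun i _ => ?_
    rw [Finset.mul_sum]
    refine Finset.sum_le_sum fun j _ => ?_
    rw [norm_smul, mul_pow, Real.norm_eq_abs, sq_abs, ← mul_assoc]
    refine mul_le_mul_of_nonneg_right ?_ (sq_nonneg _)
    unfold pairWeight peerWeight
    have hii : peerInd (X.P k ω) i ^ 2 = peerInd (X.P k ω) i := by
      unfold peerInd; split_ifs <;> norm_num
    have hjj : peerInd (X.P k ω) j ^ 2 = peerInd (X.P k ω) j := by
      unfold peerInd; split_ifs <;> norm_num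
    calc _ = ((X.P k ω).card : ℝ)⁻¹ ^ 2 * (peerInd (X.P k ω) i * peerInd (X.P k ω) j) := by ring
      _ ≤ (2 * ((X.P (a * τ) ω).card : ℝ)⁻¹) ^ 2
          * (peerInd (X.P k ω) i * peerInd (X.P k ω) j) := by
        refine mul_le_mul_of_nonneg_right (pow_le_pow_left₀ (by positivity) hinv 2)
          (mul_nonneg (peerInd_nonneg _ _) (peerInd_nonneg _ _))
      _ = 4 * (((X.P (a * τ) ω).card : ℝ)⁻¹ ^ 2
          * (peerInd (X.P k ω) i ^ 2 * peerInd (X.P k ω) j ^ 2)) := by rw [hii, hjj]; ring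
      _ = _ := by ring
  linarith

theorem integral_dispersion_le
    (h : X.Admissible Pr f μ L σ δpv₁ δpv₂ δaq γ τ Nmin d M T θ₀ θstar) (a t : ℕ)
    (ht : t < τ) :
    ∫ ω, X.dispersion (a * τ) (a * τ + t) ω ∂Pr
      ≤ 2 * (γ ^ 2 * δaq ^ 2) + t * (4 * γ ^ 2 * σ ^ 2) := by
  induction t with
  | zero =>
    rw [add_zero]
    simp_rw [h.dispersion_self]
    rw [integral_const_mul]
    have := h.avg.averaging a
    simp only [Nat.cast_zero, zero_mul, add_zero]
    linarith
  | succ t ih =>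
    have hτ : ¬ τ ∣ a * τ + t + 1 := by
      rw [add_assoc, Nat.dvd_add_right (Dvd.intro_left a rfl)]
      exact Nat.not_dvd_of_pos_of_lt (Nat.succ_pos t) ht
    have h1 := h.integral_dispersion_succ_le (Nat.le_add_right (a * τ) t) hτ
    have h2 := ih (by omega)
    rw [← add_assoc]
    push_cast
    linarith

end Admissible

end MoshpitRun

/-! ### One iteration of the averaged iterates -/

namespace MoshpitRun

variable {Ω : Type*} [mΩ : MeasurableSpace Ω] {n N : ℕ}

namespace Admissible

variable {X : MoshpitRun Ω n N} {Pr : Measure Ω} [IsProbabilityMeasure Pr] {f : Vec n → ℝ}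
  {μ L σ δpv₁ δpv₂ δaq γ : ℝ} {τ Nmin d M T : ℕ} {θ₀ θstar : Vec n}

omit [IsProbabilityMeasure Pr] in
theorem memLp_weight_noise
    (h : X.Admissible Pr f μ L σ δpv₁ δpv₂ δaq γ τ Nmin d M T θ₀ θstar) (k : ℕ) (i : Fin N) :
    MemLp (fun ω => peerWeight (X.P k ω) i • X.noise f k i ω) 2 Pr :=
  h.memLp_noise_smul k i (measurable_weight k i) fun ω => by
    rw [abs_of_nonneg (peerWeight_nonneg _ _)]
    exact (peerWeight_le _ _).trans (peerInd_le_one _ _)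

omit [IsProbabilityMeasure Pr] in
theorem measurable_weight_history (k : ℕ) (i : Fin N) :
    Measurable[X.history k] fun ω => peerWeight (X.P k ω) i :=
  (X.measurable_P_history le_rfl).of_peers fun S => peerWeight S i

/-- Averaging reduces the variance of the noise by the number of peers, because the noises of
different peers are orthogonal. -/
theorem integral_noise_avg_sq_le
    (h : X.Admissible Pr f μ L σ δpv₁ δpv₂ δaq γ τ Nmin d M T θ₀ θstar) (k : ℕ) :
    ∫ ω, ‖∑ i, peerWeight (X.P k ω) i • X.noise f k i ω‖ ^ 2 ∂Pr ≤ σ ^ 2 / Nmin := by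
  set w : Fin N → Ω → ℝ := fun i ω => peerWeight (X.P k ω) i with hw
  have hw0 : ∀ i ω, 0 ≤ w i ω := fun i ω => peerWeight_nonneg _ _
  have hw1 : ∀ i ω, w i ω ≤ 1 := fun i ω => (peerWeight_le _ _).trans (peerInd_le_one _ _)
  have hwm : ∀ i, Measurable[X.history k] (w i) := measurable_weight_history k
  have hww0 : ∀ i j ω, 0 ≤ w i ω * w j ω := fun i j ω => mul_nonneg (hw0 i ω) (hw0 j ω)
  have hww1 : ∀ i j ω, w i ω * w j ω ≤ 1 := fun i j ω =>
    mul_le_one₀ (hw1 i ω) (hw0 j ω) (hw1 j ω)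
  have hwwm : ∀ i j, Measurable[X.history k] fun ω => w i ω * w j ω := fun i j =>
    Measurable.mul (hwm i) (hwm j)
  have hwwm' : ∀ i j, Measurable fun ω => w i ω * w j ω := fun i j =>
    (hwwm i j).mono (X.history_le k) le_rfl
  have hYL : ∀ i j, MemLp (fun ω => (w i ω * w j ω) • X.noise f k j ω) 2 Pr := fun i j =>
    h.memLp_noise_smul k j (hwwm' i j) fun ω => by
      rw [abs_of_nonneg (hww0 i j ω)]; exact hww1 i j ω
  have hint : ∀ i j, Integrable
      (fun ω => ⟪X.noise f k i ω, (w i ω * w j ω) • X.noise f k j ω⟫) Pr := fun i j =>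
    (h.var.memLp_noise h.smooth k i).integrable_inner_vec (hYL i j)
  have hoff : ∀ i j, j ≠ i →
      ∫ ω, ⟪X.noise f k i ω, (w i ω * w j ω) • X.noise f k j ω⟫ ∂Pr = 0 := fun i j hij =>
    h.var.integral_inner_noise h.smooth k i (Measurable.smul
      ((hwwm i j).mono (le_sup_left : X.history k ≤ X.rest k i) le_rfl) (measurable_noise_rest h.smooth k hij)) (hYL i j)
  have hdiag : ∀ i, ∫ ω, ⟪X.noise f k i ω, (w i ω * w i ω) • X.noise f k i ω⟫ ∂Pr
      ≤ σ ^ 2 * ∫ ω, w i ω * w i ω ∂Pr := by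
    intro i
    simp_rw [real_inner_smul_right, real_inner_self_eq_norm_sq]
    exact h.var.integral_mul_noise_sq_le h.smooth k i ((hwwm i i).mono le_sup_left le_rfl)
      (hww0 i i) (hww1 i i)
  have hwwi : ∀ i, Integrable (fun ω => w i ω * w i ω) Pr := fun i =>
    Integrable.of_bound (hwwm' i i).aestronglyMeasurable 1 (Filter.Eventually.of_forall fun ω => by
      rw [Real.norm_eq_abs, abs_of_nonneg (hww0 i i ω)]; exact hww1 i i ω)
  have e : ∀ ω, ‖∑ i, w i ω • X.noise f k i ω‖ ^ 2
      = ∑ i, ∑ j, ⟪X.noise f k i ω, (w i ω * w j ω) • X.noise f k j ω⟫ := by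
    intro ω
    rw [← real_inner_self_eq_norm_sq, sum_inner]
    refine Finset.sum_congr rfl fun i _ => ?_
    rw [inner_sum]
    refine Finset.sum_congr rfl fun j _ => ?_
    rw [real_inner_smul_left, real_inner_smul_right, real_inner_smul_right]
    ring
  calc ∫ ω, ‖∑ i, w i ω • X.noise f k i ω‖ ^ 2 ∂Pr
      = ∑ i, ∑ j, ∫ ω, ⟪X.noise f k i ω, (w i ω * w j ω) • X.noise f k j ω⟫ ∂Pr := by
        simp_rw [e]
        rw [integral_finsetSum _ fun i _ => integrable_finsetSum _ fun j _ => hint i j]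
        exact Finset.sum_congr rfl fun i _ => integral_finsetSum _ fun j _ => hint i j
    _ = ∑ i, ∫ ω, ⟪X.noise f k i ω, (w i ω * w i ω) • X.noise f k i ω⟫ ∂Pr :=
        Finset.sum_congr rfl fun i _ => Finset.sum_eq_single i (fun j _ hj => hoff i j hj)
          (by simp)
    _ ≤ ∑ i, σ ^ 2 * ∫ ω, w i ω * w i ω ∂Pr := Finset.sum_le_sum fun i _ => hdiag i
    _ = σ ^ 2 * ∫ ω, ∑ i, w i ω * w i ω ∂Pr := by
        rw [← Finset.mul_sum, integral_finsetSum _ fun i _ => hwwi i]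
    _ ≤ σ ^ 2 * ∫ _, (Nmin : ℝ)⁻¹ ∂Pr := by
        refine mul_le_mul_of_nonneg_left (integral_mono (integrable_finsetSum _ fun i _ => hwwi i)
          (integrable_const _) fun ω => ?_) (sq_nonneg σ)
        simp only [hw, sum_peerWeight_sq]
        have h1 : (0 : ℝ) < Nmin := by exact_mod_cast h.Nmin_pos
        exact inv_anti₀ h1 (by exact_mod_cast h.avg.le_card_peers k ω)
    _ = σ ^ 2 / Nmin := by simp [div_eq_mul_inv]

theorem memLp_avg_grad (h : X.Admissible Pr f μ L σ δpv₁ δpv₂ δaq γ τ Nmin d M T θ₀ θstar)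
    (k : ℕ) :
    MemLp (fun ω => ∑ i, peerWeight (X.P k ω) i • gradient f (X.θ k i ω)) 2 Pr :=
  memLp_finsetSum _ fun i _ => h.memLp_smul_grad k i (measurable_weight k i)
    (fun _ => peerWeight_nonneg _ _) fun _ => peerWeight_le _ _

omit [IsProbabilityMeasure Pr] in
theorem hat_eq (f : Vec n → ℝ) (γ : ℝ) (k : ℕ) (ω : Ω) :
    X.hat γ k ω = X.mean k ω - γ • ∑ i, peerWeight (X.P k ω) i • gradient f (X.θ k i ω)
      - γ • ∑ i, peerWeight (X.P k ω) i • X.noise f k i ω := by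
  rw [X.mean_eq, hat, peerAvg_eq_sum, Finset.smul_sum, Finset.smul_sum, ← Finset.sum_sub_distrib,
    ← Finset.sum_sub_distrib]
  refine Finset.sum_congr rfl fun i _ => ?_
  simp only [noise, smul_sub, smul_comm γ]
  abel

theorem memLp_hat (h : X.Admissible Pr f μ L σ δpv₁ δpv₂ δaq γ τ Nmin d M T θ₀ θstar)
    (k : ℕ) : MemLp (X.hat γ k) 2 Pr := by
  have : X.hat γ k = fun ω => X.mean k ω
      - γ • ∑ i, peerWeight (X.P k ω) i • gradient f (X.θ k i ω)
      - γ • ∑ i, peerWeight (X.P k ω) i • X.noise f k i ω := funext (hat_eq f γ k)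
  rw [this]
  exact ((h.memLp_mean k).sub ((h.memLp_avg_grad k).const_smul γ)).sub
    ((memLp_finsetSum _ fun i _ => h.memLp_weight_noise k i).const_smul γ)

/-- The expected effect of an iteration, before peers leave and before the averaging step. -/
theorem integral_hat_le (h : X.Admissible Pr f μ L σ δpv₁ δpv₂ δaq γ τ Nmin d M T θ₀ θstar)
    (k : ℕ) :
    ∫ ω, ‖X.hat γ k ω - θstar‖ ^ 2 ∂Pr
      ≤ (1 - γ * μ) * ∫ ω, ‖X.mean k ω - θstar‖ ^ 2 ∂Pr
        - 3 / 2 * γ * ∫ ω, (f (X.mean k ω) - f θstar) ∂Pr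
        + γ * (γ * (σ ^ 2 / Nmin)
          + 24 * γ ^ 2 * L * (((τ : ℝ) - 1) * σ ^ 2 + δaq ^ 2)) := by
  obtain ⟨a, t, ht, rfl⟩ : ∃ a t, t < τ ∧ k = a * τ + t :=
    ⟨k / τ, k % τ, Nat.mod_lt _ h.τ_pos, (Nat.div_add_mod' k τ).symm⟩
  set k := a * τ + t with hk
  have hkle : k ≤ (a + 1) * τ := by rw [hk, add_mul, one_mul]; omega
  set Y : Ω → Vec n := fun ω => X.mean k ω
    - γ • ∑ i, peerWeight (X.P k ω) i • gradient f (X.θ k i ω) - θstar with hY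
  set Z : Ω → Vec n := fun ω => ∑ i, peerWeight (X.P k ω) i • X.noise f k i ω with hZ
  have hY2 : MemLp Y 2 Pr :=
    ((h.memLp_mean k).sub ((h.memLp_avg_grad k).const_smul γ)).sub (memLp_const θstar)
  have hZ2 : MemLp Z 2 Pr := memLp_finsetSum _ fun i _ => h.memLp_weight_noise k i
  have hYm : Measurable[X.history k] Y := by
    have e : Y = fun ω => ∑ i, peerWeight (X.P k ω) i • X.θ k i ω
        - γ • ∑ i, peerWeight (X.P k ω) i • gradient f (X.θ k i ω) - θstar := by
      simp only [hY, X.mean_eq]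
    rw [e]
    exact Measurable.sub (Measurable.sub
      (Finset.measurable_sum _ fun i _ =>
        Measurable.smul (measurable_weight_history k i) (X.measurable_θ_history k i))
      (Measurable.const_smul (Finset.measurable_sum _ fun i _ =>
        Measurable.smul (measurable_weight_history k i)
          (h.smooth.continuous_gradient.measurable.comp (X.measurable_θ_history k i))) γ))
      measurable_const
  have hYZ : ∫ ω, ⟪Y ω, Z ω⟫ ∂Pr = 0 := by
    have hwY : ∀ i, MemLp (fun ω => peerWeight (X.P k ω) i • Y ω) 2 Pr := fun i =>
      MemLp.smul_of_abs_le (b := fun _ => 1) (by simpa using hY2)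
        (hYm.mono (X.history_le k) le_rfl) (measurable_weight k i) fun ω => by
          rw [abs_of_nonneg (peerWeight_nonneg _ _), abs_one]
          exact (peerWeight_le _ _).trans (peerInd_le_one _ _)
    have e : ∀ ω, ⟪Y ω, Z ω⟫ = ∑ i, ⟪X.noise f k i ω, peerWeight (X.P k ω) i • Y ω⟫ := by
      intro ω
      rw [hZ, inner_sum]
      refine Finset.sum_congr rfl fun i _ => ?_
      rw [real_inner_smul_right, real_inner_smul_right, real_inner_comm]
    simp_rw [e]
    rw [integral_finsetSum _ fun i _ =>
      (h.var.memLp_noise h.smooth k i).integrable_inner_vec (hwY i)]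
    exact Finset.sum_eq_zero fun i _ => h.var.integral_inner_noise h.smooth k i
      ((Measurable.smul (measurable_weight_history k i) hYm).mono le_sup_left le_rfl) (hwY i)
  have hpt : ∀ ω, ‖X.hat γ k ω - θstar‖ ^ 2
      ≤ ((1 - γ * μ) * ‖X.mean k ω - θstar‖ ^ 2 - 3 / 2 * γ * (f (X.mean k ω) - f θstar))
        + (6 * γ * L * X.dispersion (a * τ) k ω - 2 * γ * ⟪Y ω, Z ω⟫) + γ ^ 2 * ‖Z ω‖ ^ 2 := by
    intro ω
    have e : X.hat γ k ω - θstar = Y ω - γ • Z ω := by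
      rw [hat_eq f γ k ω]; simp only [hY, hZ]; abel
    have h1 := h.convex.averaged_step h.μ_nonneg h.L_pos h.smooth h.isMin h.γ_pos.le h.γ_mul_L
      (peerWeight_nonneg (X.P k ω)) (sum_peerWeight (h.peers_nonempty k ω))
      (fun i => X.θ k i ω) (X.mean_eq k ω)
    have h2 := h.variance_le_dispersion hkle ω
    have h3 := mul_le_mul_of_nonneg_left h2
      (mul_nonneg (mul_nonneg (by norm_num : (0 : ℝ) ≤ 3) h.γ_pos.le) h.L_pos.le)
    rw [e, norm_sub_sq_real, inner_smul_right, norm_smul, mul_pow, Real.norm_eq_abs, sq_abs]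
    linarith
  have j1 := ((h.memLp_mean k).sub (memLp_const θstar)).integrable_norm_pow two_ne_zero
  have j2 := h.integrable_sub_min (h.memLp_mean k)
  have j3 := h.integrable_dispersion (a * τ) k
  have j4 := hY2.integrable_inner_vec hZ2
  have j5 := hZ2.integrable_norm_pow two_ne_zero
  have i1 := (j1.const_mul (1 - γ * μ)).sub (j2.const_mul (3 / 2 * γ))
  have i2 := (j3.const_mul (6 * γ * L)).sub (j4.const_mul (2 * γ))
  have i3 := j5.const_mul (γ ^ 2)
  refine (integral_mono_of_nonneg (Filter.Eventually.of_forall fun ω => sq_nonneg _)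
    ((i1.add i2).add i3) (Filter.Eventually.of_forall hpt)).trans ?_
  rw [integral_add' (i1.add i2) i3, integral_add' i1 i2,
    integral_sub' (j1.const_mul (1 - γ * μ)) (j2.const_mul (3 / 2 * γ)),
    integral_sub' (j3.const_mul (6 * γ * L)) (j4.const_mul (2 * γ)),
    integral_const_mul, integral_const_mul, integral_const_mul, integral_const_mul,
    integral_const_mul, hYZ]
  have b1 := mul_le_mul_of_nonneg_left (h.integral_noise_avg_sq_le k) (sq_nonneg γ)
  have b2 : ∫ ω, X.dispersion (a * τ) k ω ∂Pr
      ≤ 4 * γ ^ 2 * (((τ : ℝ) - 1) * σ ^ 2 + δaq ^ 2) := by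
    refine (h.integral_dispersion_le a t ht).trans ?_
    have c1 : (t : ℝ) ≤ τ - 1 := by
      have : (t : ℝ) + 1 ≤ τ := by exact_mod_cast ht
      linarith
    have c2 := mul_le_mul_of_nonneg_right c1 (by positivity : 0 ≤ 4 * γ ^ 2 * σ ^ 2)
    have c3 : 0 ≤ γ ^ 2 * δaq ^ 2 := by positivity
    linarith
  have b3 := mul_le_mul_of_nonneg_left b2
    (mul_nonneg (mul_nonneg (by norm_num : (0 : ℝ) ≤ 6) h.γ_pos.le) h.L_pos.le)
  simp only [Pi.sub_apply]
  change _ + γ ^ 2 * ∫ ω, ‖Z ω‖ ^ 2 ∂Pr ≤ _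
  linarith

theorem integral_mean_succ_le
    (h : X.Admissible Pr f μ L σ δpv₁ δpv₂ δaq γ τ Nmin d M T θ₀ θstar) (k : ℕ) :
    ∫ ω, ‖X.mean (k + 1) ω - θstar‖ ^ 2 ∂Pr
      ≤ (1 - γ * (μ * (1 - δpv₁))) * ∫ ω, ‖X.mean k ω - θstar‖ ^ 2 ∂Pr
        - 3 / 2 * γ * ∫ ω, (f (X.mean k ω) - f θstar) ∂Pr
        + γ * (γ * (δpv₂ ^ 2 + σ ^ 2 / Nmin)
          + 24 * γ ^ 2 * L * (((τ : ℝ) - 1) * σ ^ 2 + δaq ^ 2)) := by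
  have h1 := h.integral_hat_le k
  have h2 := h.avg.vanishing k
  have e : ∀ ω, ⟪X.mean (k + 1) ω - X.hat γ k ω,
      X.mean (k + 1) ω + X.hat γ k ω - (2 : ℝ) • θstar⟫
      = ‖X.mean (k + 1) ω - θstar‖ ^ 2 - ‖X.hat γ k ω - θstar‖ ^ 2 := by
    intro ω
    have e1 : X.mean (k + 1) ω - X.hat γ k ω
        = (X.mean (k + 1) ω - θstar) - (X.hat γ k ω - θstar) := by abel
    have e2 : X.mean (k + 1) ω + X.hat γ k ω - (2 : ℝ) • θstar
        = (X.mean (k + 1) ω - θstar) + (X.hat γ k ω - θstar) := by rw [two_smul]; abel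
    have e3 : ∀ p q : Vec n, ⟪p - q, p + q⟫ = ‖p‖ ^ 2 - ‖q‖ ^ 2 := by
      intro p q
      rw [inner_add_right, inner_sub_left, inner_sub_left, real_inner_self_eq_norm_sq,
        real_inner_self_eq_norm_sq, real_inner_comm q p]
      ring
    rw [e1, e2, e3]
  have i1 : Integrable (fun ω => ‖X.mean (k + 1) ω - θstar‖ ^ 2) Pr :=
    ((h.memLp_mean (k + 1)).sub (memLp_const θstar)).integrable_norm_pow two_ne_zero
  have i2 : Integrable (fun ω => ‖X.hat γ k ω - θstar‖ ^ 2) Pr :=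
    ((h.memLp_hat k).sub (memLp_const θstar)).integrable_norm_pow two_ne_zero
  simp_rw [e] at h2
  rw [integral_sub i1 i2] at h2
  linarith

end Admissible

/-! ### The weighted average of the iterates -/

omit mΩ in
theorem weight_pos {γ ρ : ℝ} (hp : 0 < 1 - γ * ρ) (k : ℕ) : 0 < weight γ ρ k :=
  inv_pos.2 (pow_pos hp _)

theorem output_eq (X : MoshpitRun Ω n N) (γ ρ : ℝ) (K : ℕ) (ω : Ω) :
    X.output γ ρ K ω = ∑ k ∈ Finset.range (K + 1),
      ((∑ k ∈ Finset.range (K + 1), weight γ ρ k)⁻¹ * weight γ ρ k) • X.mean k ω := by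
  unfold output
  rw [Finset.smul_sum]
  refine Finset.sum_congr rfl fun k _ => ?_
  rw [mul_smul]
  congr 1
  unfold mean peerAvg
  rw [← Finset.smul_sum, smul_comm]

theorem Admissible.integral_output_le {X : MoshpitRun Ω n N} {Pr : Measure Ω}
    [IsProbabilityMeasure Pr] {f : Vec n → ℝ} {μ L σ δpv₁ δpv₂ δaq γ : ℝ} {τ Nmin d M T : ℕ}
    {θ₀ θstar : Vec n} (h : X.Admissible Pr f μ L σ δpv₁ δpv₂ δaq γ τ Nmin d M T θ₀ θstar)
    {ρ : ℝ} (hp : 0 < 1 - γ * ρ) (K : ℕ) :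
    Integrable (fun ω => f (X.output γ ρ K ω) - f θstar) Pr ∧
      ∫ ω, (f (X.output γ ρ K ω) - f θstar) ∂Pr
        ≤ (∑ k ∈ Finset.range (K + 1), weight γ ρ k)⁻¹ * ∑ k ∈ Finset.range (K + 1),
          weight γ ρ k * ∫ ω, (f (X.mean k ω) - f θstar) ∂Pr := by
  set W := ∑ k ∈ Finset.range (K + 1), weight γ ρ k with hW
  have hW0 : 0 < W := Finset.sum_pos (fun k _ => weight_pos hp k) (by simp)
  have hα0 : ∀ k ∈ Finset.range (K + 1), 0 ≤ W⁻¹ * weight γ ρ k := fun k _ =>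
    mul_nonneg (inv_nonneg.2 hW0.le) (weight_pos hp k).le
  have hα1 : ∑ k ∈ Finset.range (K + 1), W⁻¹ * weight γ ρ k = 1 := by
    rw [← Finset.mul_sum, ← hW, inv_mul_cancel₀ hW0.ne']
  have hout : MemLp (X.output γ ρ K) 2 Pr := by
    have : X.output γ ρ K = fun ω => ∑ k ∈ Finset.range (K + 1),
        (W⁻¹ * weight γ ρ k) • X.mean k ω := funext (X.output_eq γ ρ K)
    rw [this]
    exact memLp_finsetSum _ fun k _ => (h.memLp_mean k).const_smul (W⁻¹ * weight γ ρ k)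
  have hint := h.integrable_sub_min hout
  refine ⟨hint, ?_⟩
  have hi : ∀ k, Integrable (fun ω => W⁻¹ * weight γ ρ k * (f (X.mean k ω) - f θstar)) Pr :=
    fun k => (h.integrable_sub_min (h.memLp_mean k)).const_mul _
  calc ∫ ω, (f (X.output γ ρ K ω) - f θstar) ∂Pr
      ≤ ∫ ω, ∑ k ∈ Finset.range (K + 1),
          W⁻¹ * weight γ ρ k * (f (X.mean k ω) - f θstar) ∂Pr := by
        refine integral_mono hint (integrable_finsetSum _ fun k _ => hi k) fun ω => ?_
        have h1 := h.convex.map_sum_le h.μ_nonneg (Finset.range (K + 1)) hα0 hα1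
          fun k => X.mean k ω
        have ho := X.output_eq γ ρ K ω
        rw [← hW] at ho
        rw [← ho] at h1
        simp_rw [mul_sub]
        rw [Finset.sum_sub_distrib, ← Finset.sum_mul, hα1, one_mul]
        exact sub_le_sub_right h1 _
    _ = W⁻¹ * ∑ k ∈ Finset.range (K + 1),
          weight γ ρ k * ∫ ω, (f (X.mean k ω) - f θstar) ∂Pr := by
        rw [integral_finsetSum _ fun k _ => hi k, Finset.mul_sum]
        exact Finset.sum_congr rfl fun k _ => by rw [integral_const_mul, mul_assoc]

end MoshpitRun

/-! ### Solving the recursion -/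

section Recursion

variable {a r : ℕ → ℝ} {γ μ δ e : ℝ}

open MoshpitRun in
/-- Multiply the recursion by the weights and add up. The weights absorb a contraction at rate `ρ`;
where `ρ` exceeds the rate `μ (1 - δ)` of the recursion, the distances `a k` remain. -/
theorem weighted_telescope
    (hrec : ∀ k, a (k + 1) ≤ (1 - γ * (μ * (1 - δ))) * a k - 3 / 2 * γ * r k + γ * e)
    {ρ : ℝ} (hp : 0 < 1 - γ * ρ) (m : ℕ) :
    3 / 2 * γ * ∑ k ∈ Finset.range m, weight γ ρ k * r k + ((1 - γ * ρ) ^ m)⁻¹ * a m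
      ≤ a 0 + γ * (ρ - μ * (1 - δ)) * ∑ k ∈ Finset.range m, weight γ ρ k * a k
        + γ * e * ∑ k ∈ Finset.range m, weight γ ρ k := by
  induction m with
  | zero => simp
  | succ m ih =>
    rw [Finset.sum_range_succ, Finset.sum_range_succ, Finset.sum_range_succ]
    have h1 : ((1 - γ * ρ) ^ m)⁻¹ = weight γ ρ m * (1 - γ * ρ) := by
      unfold weight
      rw [pow_succ]
      field_simp
    have h2 : ((1 - γ * ρ) ^ (m + 1))⁻¹ = weight γ ρ m := rfl
    have h3 := mul_le_mul_of_nonneg_left (hrec m) (weight_pos hp m).le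
    rw [h1] at ih
    rw [h2]
    linarith

/-- The distances contract at the rate `μ / 2`, whatever `δ` is: strong convexity turns the
decrease of the function values into an additional contraction. -/
theorem distance_bound (ha : ∀ k, 0 ≤ a k) (hγ : 0 < γ) (hμ : 0 ≤ μ) (hδ : δ < 1)
    (hγμ : γ * μ ≤ 1) (he : 0 ≤ e) (hr : ∀ k, μ / 2 * a k ≤ r k)
    (hrec : ∀ k, a (k + 1) ≤ (1 - γ * (μ * (1 - δ))) * a k - 3 / 2 * γ * r k + γ * e) (k : ℕ) :
    μ * a k ≤ μ * ((1 - γ * μ / 2) ^ k * a 0) + 2 * e := by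
  induction k with
  | zero => simp; linarith
  | succ k ih =>
    have h1 := mul_le_mul_of_nonneg_left (hr k) hγ.le
    have h2 : 0 ≤ γ * μ * a k := mul_nonneg (mul_nonneg hγ.le hμ) (ha k)
    have h3 : 0 ≤ γ * μ * a k * (1 - δ) := mul_nonneg h2 (sub_nonneg.2 hδ.le)
    have h4 : a (k + 1) ≤ (1 - γ * μ / 2) * a k + γ * e := by linarith [hrec k]
    have h5 := mul_le_mul_of_nonneg_left h4 hμ
    have h6 := mul_le_mul_of_nonneg_left ih (by linarith : 0 ≤ 1 - γ * μ / 2)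
    calc μ * a (k + 1) ≤ (1 - γ * μ / 2) * (μ * a k) + μ * γ * e := by linarith
      _ ≤ (1 - γ * μ / 2) * (μ * ((1 - γ * μ / 2) ^ k * a 0) + 2 * e) + μ * γ * e := by linarith
      _ = μ * ((1 - γ * μ / 2) ^ (k + 1) * a 0) + 2 * e := by ring

open MoshpitRun in
theorem sum_weight_mul_pow (hp : 0 < 1 - γ * μ) (m : ℕ) :
    γ * μ * ∑ k ∈ Finset.range m, weight γ μ k * (1 - γ * μ / 2) ^ k
      = 2 * (((1 - γ * μ) ^ m)⁻¹ * (1 - γ * μ / 2) ^ m - 1) := by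
  induction m with
  | zero => simp
  | succ m ih =>
    rw [Finset.sum_range_succ, mul_add, ih]
    unfold weight
    rw [pow_succ, pow_succ]
    field_simp
    ring

open MoshpitRun in
/-- The weighted sum of the function values, for both choices of the weights. -/
theorem weighted_sum_le (ha : ∀ k, 0 ≤ a k) (hγ : 0 < γ) (hμ : 0 ≤ μ) (hδ0 : 0 ≤ δ) (hδ : δ < 1)
    (hγμ : γ * μ < 1) (he : 0 ≤ e) (hr : ∀ k, μ / 2 * a k ≤ r k)
    (hrec : ∀ k, a (k + 1) ≤ (1 - γ * (μ * (1 - δ))) * a k - 3 / 2 * γ * r k + γ * e)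
    {ρ : ℝ} (hρ : ρ = μ ∨ ρ = μ * (1 - δ)) (m : ℕ) :
    3 / 2 * γ * ∑ k ∈ Finset.range m, weight γ ρ k * r k
      ≤ 2 * a 0 * (1 - γ * (μ * (1 - δ)) / 2) ^ m * ((1 - γ * ρ) ^ m)⁻¹
        + 3 * γ * e * ∑ k ∈ Finset.range m, weight γ ρ k := by
  have hμδ : γ * (μ * (1 - δ)) ≤ γ * μ := by
    have : 0 ≤ γ * (μ * δ) := by positivity
    linarith
  have hμδ0 : 0 ≤ γ * (μ * (1 - δ)) :=
    mul_nonneg hγ.le (mul_nonneg hμ (sub_nonneg.2 hδ.le))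
  have hp : 0 < 1 - γ * ρ := by rcases hρ with rfl | rfl <;> linarith
  have hW : 0 ≤ ∑ k ∈ Finset.range m, weight γ ρ k :=
    Finset.sum_nonneg fun k _ => (weight_pos hp k).le
  have h1 := weighted_telescope hrec hp m
  have h2 : 0 ≤ ((1 - γ * ρ) ^ m)⁻¹ * a m := mul_nonneg (inv_nonneg.2 (pow_nonneg hp.le m)) (ha m)
  have h3 : 0 ≤ γ * e * ∑ k ∈ Finset.range m, weight γ ρ k := by positivity
  rcases hρ with rfl | rfl
  · have h4 : γ * (ρ - ρ * (1 - δ)) * ∑ k ∈ Finset.range m, weight γ ρ k * a k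
        ≤ a 0 * (γ * ρ * ∑ k ∈ Finset.range m, weight γ ρ k * (1 - γ * ρ / 2) ^ k)
          + 2 * (γ * e * ∑ k ∈ Finset.range m, weight γ ρ k) := by
      simp only [Finset.mul_sum]
      rw [← Finset.sum_add_distrib]
      refine Finset.sum_le_sum fun k _ => ?_
      have h5 := distance_bound ha hγ hμ hδ hγμ.le he hr hrec k
      have hw := weight_pos hp k
      have h6 := mul_le_mul_of_nonneg_left h5 (mul_nonneg hγ.le hw.le)
      have h7 : 0 ≤ (1 - δ) * (γ * weight γ ρ k * (ρ * a k)) :=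
        mul_nonneg (sub_nonneg.2 hδ.le)
          (mul_nonneg (mul_nonneg hγ.le hw.le) (mul_nonneg hμ (ha k)))
      linarith
    rw [sum_weight_mul_pow hp] at h4
    have h5 : (1 - γ * ρ / 2) ^ m ≤ (1 - γ * (ρ * (1 - δ)) / 2) ^ m :=
      pow_le_pow_left₀ (by linarith) (by linarith) m
    have h6 := mul_le_mul_of_nonneg_left h5
      (mul_nonneg (ha 0) (inv_nonneg.2 (pow_nonneg hp.le m)))
    linarith [ha 0]
  · have h4 : (1 - γ * (μ * (1 - δ))) ^ m ≤ (1 - γ * (μ * (1 - δ)) / 2) ^ m :=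
      pow_le_pow_left₀ hp.le (by linarith) m
    have h5 := mul_le_mul_of_nonneg_left h4
      (mul_nonneg (ha 0) (inv_nonneg.2 (pow_nonneg hp.le m)))
    have h6 : a 0 * ((1 - γ * (μ * (1 - δ))) ^ m)⁻¹ * (1 - γ * (μ * (1 - δ))) ^ m = a 0 := by
      rw [mul_assoc, inv_mul_cancel₀ (pow_pos hp m).ne', mul_one]
    rw [h6] at h5
    have h7 := ha 0
    rw [sub_self, mul_zero, zero_mul, add_zero] at h1
    linarith

end Recursion

/-! ### Convergence for a given stepsize -/

namespace MoshpitRun.Admissible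

variable {Ω : Type*} [mΩ : MeasurableSpace Ω] {n N : ℕ} {X : MoshpitRun Ω n N} {Pr : Measure Ω}
  [IsProbabilityMeasure Pr] {f : Vec n → ℝ} {μ L σ δpv₁ δpv₂ δaq γ : ℝ} {τ Nmin d M T : ℕ}
  {θ₀ θstar : Vec n}

theorem integral_mean_zero (h : X.Admissible Pr f μ L σ δpv₁ δpv₂ δaq γ τ Nmin d M T θ₀ θstar) :
    ∫ ω, ‖X.mean 0 ω - θstar‖ ^ 2 ∂Pr = ‖θ₀ - θstar‖ ^ 2 := by
  have e : ∀ ω, X.mean 0 ω = θ₀ := by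
    intro ω
    rw [X.mean_eq]
    simp_rw [h.run.initial_point]
    rw [← Finset.sum_smul, sum_peerWeight (h.peers_nonempty 0 ω), one_smul]
  simp_rw [e]
  simp

omit [IsProbabilityMeasure Pr] in
theorem error_nonneg (h : X.Admissible Pr f μ L σ δpv₁ δpv₂ δaq γ τ Nmin d M T θ₀ θstar) :
    0 ≤ γ * (δpv₂ ^ 2 + σ ^ 2 / Nmin)
      + 24 * γ ^ 2 * L * (((τ : ℝ) - 1) * σ ^ 2 + δaq ^ 2) := by
  have h1 := h.γ_pos
  have h2 := h.L_pos
  have h3 : (0 : ℝ) ≤ (τ : ℝ) - 1 := sub_nonneg.2 (by exact_mod_cast h.τ_pos)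
  positivity

theorem convergence_stronglyConvex
    (h : X.Admissible Pr f μ L σ δpv₁ δpv₂ δaq γ τ Nmin d M T θ₀ θstar)
    (hδ0 : 0 ≤ δpv₁) (hδ1 : δpv₁ < 1) {ρ : ℝ} (hρ : ρ = μ ∨ ρ = μ * (1 - δpv₁)) (K : ℕ) :
    Integrable (fun ω => f (X.output γ ρ K ω) - f θstar) Pr ∧
      ∫ ω, (f (X.output γ ρ K ω) - f θstar) ∂Pr
        ≤ 4 / 3 * (‖θ₀ - θstar‖ ^ 2 / γ) * (1 - γ * (μ * (1 - δpv₁)) / 2) ^ (K + 1)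
          + 2 * (γ * (δpv₂ ^ 2 + σ ^ 2 / Nmin)
            + 24 * γ ^ 2 * L * (((τ : ℝ) - 1) * σ ^ 2 + δaq ^ 2)) := by
  have hγ := h.γ_pos
  have hμ := h.μ_nonneg
  have hγμ : γ * μ < 1 := by
    have := mul_le_mul_of_nonneg_left h.μ_le_L hγ.le
    linarith [h.γ_mul_L]
  have hμδ : γ * (μ * (1 - δpv₁)) ≤ γ * μ := by
    have : 0 ≤ γ * (μ * δpv₁) := by positivity
    linarith
  have hp : 0 < 1 - γ * ρ := by rcases hρ with rfl | rfl <;> linarith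
  obtain ⟨h1, h2⟩ := h.integral_output_le hp K
  refine ⟨h1, h2.trans ?_⟩
  set e := γ * (δpv₂ ^ 2 + σ ^ 2 / Nmin)
    + 24 * γ ^ 2 * L * (((τ : ℝ) - 1) * σ ^ 2 + δaq ^ 2) with he
  set W := ∑ k ∈ Finset.range (K + 1), weight γ ρ k with hW
  have hr : ∀ k, μ / 2 * ∫ ω, ‖X.mean k ω - θstar‖ ^ 2 ∂Pr
      ≤ ∫ ω, (f (X.mean k ω) - f θstar) ∂Pr := by
    intro k
    rw [← integral_const_mul]
    exact integral_mono_of_nonneg (Filter.Eventually.of_forall fun ω => by positivity)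
      (h.integrable_sub_min (h.memLp_mean k))
      (Filter.Eventually.of_forall fun ω => h.convex.dist_sq_le h.isMin _)
  have h3 := weighted_sum_le (a := fun k => ∫ ω, ‖X.mean k ω - θstar‖ ^ 2 ∂Pr)
    (r := fun k => ∫ ω, (f (X.mean k ω) - f θstar) ∂Pr)
    (fun k => integral_nonneg fun ω => sq_nonneg _) hγ hμ hδ0 hδ1 hγμ h.error_nonneg hr
    h.integral_mean_succ_le hρ (K + 1)
  simp only [h.integral_mean_zero, ← hW, ← he] at h3
  have hwK : ((1 - γ * ρ) ^ (K + 1))⁻¹ ≤ W :=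
    Finset.single_le_sum (f := weight γ ρ) (fun k _ => (weight_pos hp k).le)
      (Finset.self_mem_range_succ K)
  have hW0 : 0 < W := (weight_pos hp K).trans_le hwK
  have hq : 0 ≤ (1 - γ * (μ * (1 - δpv₁)) / 2) ^ (K + 1) := pow_nonneg (by linarith) _
  have h4 := mul_le_mul_of_nonneg_left hwK
    (mul_nonneg (by positivity : 0 ≤ 2 * ‖θ₀ - θstar‖ ^ 2) hq)
  rw [inv_mul_le_iff₀ hW0]
  refine le_of_mul_le_mul_left ?_ (by positivity : 0 < 3 / 2 * γ)
  refine (h3.trans (add_le_add_left h4 _)).trans (le_of_eq ?_)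
  field_simp
  ring

theorem convergence_convex
    (h : X.Admissible Pr f 0 L σ δpv₁ δpv₂ δaq γ τ Nmin d M T θ₀ θstar) (K : ℕ) :
    Integrable (fun ω => f (X.output γ 0 K ω) - f θstar) Pr ∧
      ∫ ω, (f (X.output γ 0 K ω) - f θstar) ∂Pr
        ≤ 2 / 3 * (‖θ₀ - θstar‖ ^ 2 / γ / (K + 1)
          + (γ * (δpv₂ ^ 2 + σ ^ 2 / Nmin)
            + 24 * γ ^ 2 * L * (((τ : ℝ) - 1) * σ ^ 2 + δaq ^ 2))) := by
  have hγ := h.γ_pos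
  have hp : 0 < 1 - γ * 0 := by simp
  obtain ⟨h1, h2⟩ := h.integral_output_le hp K
  refine ⟨h1, h2.trans ?_⟩
  have h3 := weighted_telescope (a := fun k => ∫ ω, ‖X.mean k ω - θstar‖ ^ 2 ∂Pr)
    (r := fun k => ∫ ω, (f (X.mean k ω) - f θstar) ∂Pr) h.integral_mean_succ_le hp (K + 1)
  have h4 : (0 : ℝ) ≤ ∫ ω, ‖X.mean (K + 1) ω - θstar‖ ^ 2 ∂Pr :=
    integral_nonneg fun ω => sq_nonneg _
  have hw : ∀ k, weight γ 0 k = 1 := fun k => by simp [weight]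
  simp only [h.integral_mean_zero, hw, mul_zero, sub_zero, one_pow, inv_one, one_mul, zero_mul,
    add_zero, Finset.sum_const, Finset.card_range, nsmul_eq_mul, mul_one] at h3 ⊢
  set e := γ * (δpv₂ ^ 2 + σ ^ 2 / Nmin)
    + 24 * γ ^ 2 * L * (((τ : ℝ) - 1) * σ ^ 2 + δaq ^ 2) with he
  push_cast at h3 ⊢
  rw [inv_mul_le_iff₀ (by positivity)]
  refine le_of_mul_le_mul_left ?_ (by positivity : 0 < 3 / 2 * γ)
  refine ((le_add_of_nonneg_right h4).trans h3).trans (le_of_eq ?_)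
  field_simp

end MoshpitRun.Admissible

/-! ### The choice of the stepsize -/

/-- The reciprocal of the stepsize, up to a factor 64. -/
noncomputable def inverseStepsize (L σ δpv₂ δaq ε : ℝ) (τ Nmin : ℕ) : ℝ :=
  L + (δpv₂ ^ 2 + σ ^ 2 / Nmin) / ε + √(L * (((τ : ℝ) - 1) * σ ^ 2 + δaq ^ 2) / ε)

section Stepsize

variable {μ L σ δpv₁ δpv₂ δaq R₀ ε : ℝ} {τ Nmin : ℕ}

theorem convexComplexity_eq (hε : 0 < ε) :
    convexComplexity L σ δpv₂ δaq R₀ ε τ Nmin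
      = R₀ ^ 2 * inverseStepsize L σ δpv₂ δaq ε τ Nmin / ε := by
  have h1 : ε ^ (3 / 2 : ℝ) = ε * √ε := by
    rw [show (3 / 2 : ℝ) = 1 + 1 / 2 by norm_num, Real.rpow_add hε, Real.rpow_one,
      ← Real.sqrt_eq_rpow]
  have h2 : 0 < √ε := Real.sqrt_pos.2 hε
  unfold convexComplexity inverseStepsize
  rw [h1, Real.sqrt_div' _ hε.le]
  field_simp

theorem stronglyConvexComplexity_eq (hε : 0 < ε) (hμ : 0 < μ) (hδ : δpv₁ < 1) :
    stronglyConvexComplexity μ L σ δpv₁ δpv₂ δaq ε τ Nmin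
      = inverseStepsize L σ δpv₂ δaq ε τ Nmin / (μ * (1 - δpv₁)) := by
  have h0 : 0 < 1 - δpv₁ := sub_pos.2 hδ
  have h1 : (1 - δpv₁) ^ 2 * μ ^ 2 * ε = ε * ((1 - δpv₁) * μ) ^ 2 := by ring
  unfold stronglyConvexComplexity inverseStepsize
  rw [h1, ← div_div (L * _) ε, Real.sqrt_div' _ (sq_nonneg _), Real.sqrt_sq (by positivity)]
  field_simp

theorem inverseStepsize_nonneg (hL : 0 ≤ L) (hε : 0 < ε) :
    0 ≤ inverseStepsize L σ δpv₂ δaq ε τ Nmin := by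
  unfold inverseStepsize
  positivity

/-- With stepsize `γ = 1 / (64 S)`, the error floor is below `ε / 32`. -/
theorem error_le (hL : 0 < L) (hε : 0 < ε) (hτ : 1 ≤ τ) {γ : ℝ}
    (hγ : γ = 1 / (64 * inverseStepsize L σ δpv₂ δaq ε τ Nmin)) :
    0 < γ ∧ γ * L ≤ 1 / 64 ∧
      γ * (δpv₂ ^ 2 + σ ^ 2 / Nmin) + 24 * γ ^ 2 * L * (((τ : ℝ) - 1) * σ ^ 2 + δaq ^ 2)
        ≤ ε / 32 := by
  have hτ' : (0 : ℝ) ≤ (τ : ℝ) - 1 := sub_nonneg.2 (by exact_mod_cast hτ)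
  set c := δpv₂ ^ 2 + σ ^ 2 / (Nmin : ℝ) with hc
  set v := ((τ : ℝ) - 1) * σ ^ 2 + δaq ^ 2 with hv
  have hc0 : 0 ≤ c := by positivity
  have hv0 : 0 ≤ v := by positivity
  set S := inverseStepsize L σ δpv₂ δaq ε τ Nmin with hS
  have hSe : S = L + c / ε + √(L * v / ε) := rfl
  have q1 : 0 ≤ c / ε := by positivity
  have q2 : 0 ≤ √(L * v / ε) := Real.sqrt_nonneg _
  have hS0 : 0 < S := by linarith
  have hγ0 : 0 < γ := by rw [hγ]; positivity
  have hγS : γ * S = 1 / 64 := by rw [hγ]; field_simp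
  have k1 : γ * L ≤ 1 / 64 := by
    rw [← hγS]; exact mul_le_mul_of_nonneg_left (by linarith) hγ0.le
  have k2 : γ * (c / ε) ≤ 1 / 64 := by
    rw [← hγS]; exact mul_le_mul_of_nonneg_left (by linarith) hγ0.le
  have k3 : γ * √(L * v / ε) ≤ 1 / 64 := by
    rw [← hγS]; exact mul_le_mul_of_nonneg_left (by linarith) hγ0.le
  have k4 : γ ^ 2 * (L * v / ε) ≤ (1 / 64) ^ 2 := by
    have := pow_le_pow_left₀ (mul_nonneg hγ0.le q2) k3 2
    rwa [mul_pow, Real.sq_sqrt (by positivity)] at this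
  refine ⟨hγ0, k1, ?_⟩
  have k5 := mul_le_mul_of_nonneg_right k2 hε.le
  have k6 := mul_le_mul_of_nonneg_right k4 hε.le
  have e1 : γ * (c / ε) * ε = γ * c := by field_simp
  have e2 : γ ^ 2 * (L * v / ε) * ε = γ ^ 2 * L * v := by field_simp
  rw [e1] at k5
  rw [e2] at k6
  linarith

/-- After `1024 B ln (2 + B₀)` iterations at the contraction factor `1 - 1 / (128 B)`, the initial
error is negligible: the factor has become at most `(2 + B₀)⁻⁸`. -/
theorem pow_mul_le {B B₀ : ℝ} (hB : 0 < B) (hB₀ : 0 ≤ B₀) (hq : 1 ≤ 128 * B) {m : ℕ}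
    (hm : 1024 * B * Real.log (2 + B₀) ≤ m) :
    (1 - 1 / (128 * B)) ^ m * B₀ ≤ 1 / 128 := by
  have h1 : (1 - 1 / (128 * B)) ^ m ≤ Real.exp (-(8 * Real.log (2 + B₀))) := by
    calc (1 - 1 / (128 * B)) ^ m ≤ Real.exp (-(1 / (128 * B))) ^ m := by
          refine pow_le_pow_left₀ (sub_nonneg.2 (div_le_one_of_le₀ hq (by positivity))) ?_ m
          have := Real.add_one_le_exp (-(1 / (128 * B)))
          linarith
      _ = Real.exp (-(m / (128 * B))) := by
          rw [← Real.exp_nat_mul]; congr 1; ring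
      _ ≤ _ := by
          refine Real.exp_le_exp.2 (neg_le_neg ?_)
          rw [le_div_iff₀ (by positivity)]
          linarith
  have h2 : Real.exp (-(8 * Real.log (2 + B₀))) = ((2 + B₀) ^ 8)⁻¹ := by
    rw [Real.exp_neg, mul_comm, Real.exp_mul, Real.exp_log (by positivity)]
    norm_cast
  have h3 : 128 * B₀ ≤ (2 + B₀) ^ 8 := by
    have : (2 : ℝ) ^ 7 ≤ (2 + B₀) ^ 7 := pow_le_pow_left₀ (by norm_num) (by linarith) 7
    calc 128 * B₀ ≤ (2 + B₀) ^ 7 * (2 + B₀) := by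
          refine mul_le_mul (by linarith) (by linarith) hB₀ (by positivity)
      _ = _ := by ring
  rw [h2] at h1
  calc _ ≤ ((2 + B₀) ^ 8)⁻¹ * B₀ := mul_le_mul_of_nonneg_right h1 hB₀
    _ ≤ 1 / 128 := by
        rw [inv_mul_le_iff₀ (by positivity)]; linarith

end Stepsize

theorem theorem3 :
    ∃ C : ℝ, 0 < C ∧
      ∀ (μ L σ δpv₁ δpv₂ δaq R₀ ε : ℝ) (τ Nmin : ℕ),
        0 ≤ μ → 0 ≤ L → 0 ≤ σ → 0 ≤ δpv₁ → δpv₁ < 1 → 0 ≤ δpv₂ → 0 ≤ δaq → 0 ≤ R₀ → 0 < ε →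
        1 ≤ τ → 1 ≤ Nmin →
        ∀ ρ : ℝ, (ρ = μ ∨ ρ = μ * (1 - δpv₁)) →
        ∃ γ : ℝ, 0 < γ ∧ ∃ K₀ : ℕ,
          (0 < μ → (K₀ : ℝ) ≤ C * stronglyConvexComplexity μ L σ δpv₁ δpv₂ δaq ε τ Nmin
            * Real.log (2 + convexComplexity L σ δpv₂ δaq R₀ ε τ Nmin)) ∧
          (μ = 0 → (K₀ : ℝ) ≤ C * convexComplexity L σ δpv₂ δaq R₀ ε τ Nmin) ∧
          ∀ (n N : ℕ) (f : Vec n → ℝ) (θ₀ θstar : Vec n) (d M T : ℕ)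
            (Ω : Type*) [MeasurableSpace Ω] (Pr : Measure Ω) [IsProbabilityMeasure Pr]
            (X : MoshpitRun Ω n N),
            IsMuStronglyConvex μ f → IsLSmooth L f → (∀ x, f θstar ≤ f x) →
            ‖θ₀ - θstar‖ = R₀ → 1 ≤ d → 1 ≤ M →
            X.IsMoshpitSGD d M T θ₀ γ τ →
            X.BoundedVariance Pr f σ →
            X.AveragingQuality Pr γ μ δpv₁ δpv₂ δaq τ Nmin θstar →
            ∀ K : ℕ, K₀ ≤ K →
              Integrable (fun ω => f (X.output γ ρ K ω) - f θstar) Pr ∧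
              ∫ ω, (f (X.output γ ρ K ω) - f θstar) ∂Pr ≤ ε := by
  refine ⟨1024, by norm_num, ?_⟩
  intro μ L σ δpv₁ δpv₂ δaq R₀ ε τ Nmin hμ hL hσ hδ0 hδ1 hδ2 hδa hR₀ hε hτ hN ρ hρ
  set S := inverseStepsize L σ δpv₂ δaq ε τ Nmin with hS
  set B₀ := convexComplexity L σ δpv₂ δaq R₀ ε τ Nmin with hB₀
  have hS0 : 0 ≤ S := inverseStepsize_nonneg hL hε
  have hB₀e : B₀ = R₀ ^ 2 * S / ε := convexComplexity_eq hε
  have hB₀0 : 0 ≤ B₀ := by rw [hB₀e]; positivity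
  have hlog : 0 ≤ Real.log (2 + B₀) := Real.log_nonneg (by linarith)
  by_cases hdeg : ¬ (0 < L ∧ μ ≤ L)
  · -- `f` is constant
    refine ⟨1, one_pos, 0, fun hμ0 => ?_, fun _ => ?_, ?_⟩
    · rw [stronglyConvexComplexity_eq hε hμ0 hδ1, ← hS]
      have := sub_pos.2 hδ1
      rw [Nat.cast_zero]
      positivity
    · rw [Nat.cast_zero]; positivity
    · intro n N f θ₀ θstar d M T Ω _ Pr _ X hf hLs hmin _ _ _ _ _ _ K _
      have e : ∀ x, f x - f θstar = 0 := fun x =>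
        sub_eq_zero.2 (eq_min_of_degenerate hf hμ hLs hL hdeg hmin x)
      simp only [e]
      exact ⟨integrable_zero _ _ _, by simpa using hε.le⟩
  obtain ⟨hL0, hμL⟩ := not_not.1 hdeg
  obtain ⟨hγ0, hγL, herr⟩ := error_le (σ := σ) (δpv₂ := δpv₂) (δaq := δaq) (Nmin := Nmin)
    hL0 hε hτ rfl
  rw [← hS] at hγ0 hγL herr
  set γ := 1 / (64 * S) with hγ
  have hSpos : 0 < S := by
    rcases hS0.eq_or_lt with h0 | h0
    · rw [hγ, ← h0] at hγ0; norm_num at hγ0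
    · exact h0
  have hR : R₀ ^ 2 / γ = 64 * (B₀ * ε) := by
    rw [hγ, hB₀e]; field_simp
  rcases hμ.eq_or_lt with h0 | hμ0
  · -- convex case
    obtain rfl : μ = 0 := h0.symm
    have hρ0 : ρ = 0 := by rcases hρ with h | h <;> simpa using h
    subst hρ0
    refine ⟨γ, hγ0, ⌊1024 * B₀⌋₊, fun h => absurd h (lt_irrefl _),
      fun _ => Nat.floor_le (by positivity), ?_⟩
    intro n N f θ₀ θstar d M T Ω _ Pr _ X hf hLs hmin hdist _ _ hrun hvar havg K hK
    have had : X.Admissible Pr f 0 L σ δpv₁ δpv₂ δaq γ τ Nmin d M T θ₀ θstar :=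
      ⟨hf, hLs, hmin, le_rfl, hL0, hμL, hγ0, hγL, hτ, hN, hrun, hvar, havg⟩
    obtain ⟨hint, hle⟩ := had.convergence_convex K
    refine ⟨hint, hle.trans ?_⟩
    have hKm : 1024 * B₀ ≤ (K : ℝ) + 1 := by
      refine (Nat.lt_floor_add_one _).le.trans ?_
      have : ((⌊1024 * B₀⌋₊ : ℕ) : ℝ) ≤ K := by exact_mod_cast hK
      linarith
    have h1 : R₀ ^ 2 / γ / ((K : ℝ) + 1) ≤ ε / 16 := by
      rw [hR, div_le_iff₀ (by positivity)]
      have := mul_le_mul_of_nonneg_right hKm hε.le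
      linarith
    rw [hdist]
    linarith
  · -- strongly convex case
    have hδ : 0 < 1 - δpv₁ := sub_pos.2 hδ1
    set B := stronglyConvexComplexity μ L σ δpv₁ δpv₂ δaq ε τ Nmin with hB
    have hBe : B = S / (μ * (1 - δpv₁)) := stronglyConvexComplexity_eq hε hμ0 hδ1
    have hB0 : 0 < B := by rw [hBe]; positivity
    refine ⟨γ, hγ0, ⌊1024 * B * Real.log (2 + B₀)⌋₊, fun _ => Nat.floor_le (by positivity),
      fun h => absurd h hμ0.ne', ?_⟩
    intro n N f θ₀ θstar d M T Ω _ Pr _ X hf hLs hmin hdist _ _ hrun hvar havg K hK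
    have had : X.Admissible Pr f μ L σ δpv₁ δpv₂ δaq γ τ Nmin d M T θ₀ θstar :=
      ⟨hf, hLs, hmin, hμ, hL0, hμL, hγ0, hγL, hτ, hN, hrun, hvar, havg⟩
    obtain ⟨hint, hle⟩ := had.convergence_stronglyConvex hδ0 hδ1 hρ K
    refine ⟨hint, hle.trans ?_⟩
    have hKm : 1024 * B * Real.log (2 + B₀) ≤ ((K + 1 : ℕ) : ℝ) := by
      refine (Nat.lt_floor_add_one _).le.trans ?_
      push_cast
      have : ((⌊1024 * B * Real.log (2 + B₀)⌋₊ : ℕ) : ℝ) ≤ K := by exact_mod_cast hK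
      linarith
    have hrate : γ * (μ * (1 - δpv₁)) / 2 = 1 / (128 * B) := by
      rw [hγ, hBe]; field_simp; norm_num
    have hq : 1 ≤ 128 * B := by
      have h1 : 1 / (128 * B) ≤ 1 := by
        rw [← hrate]
        have h2 := mul_le_mul_of_nonneg_left hμL hγ0.le
        have h3 : 0 ≤ γ * (μ * δpv₁) := by positivity
        linarith
      rwa [div_le_one (by positivity)] at h1
    have h1 := mul_le_mul_of_nonneg_right (pow_mul_le hB0 hB₀0 hq hKm) hε.le
    rw [hdist, hR, hrate]
    linarith
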